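/- An étale groupoid is a locally compact Hausdorff topological groupoid $G$ with unit space $G^{(0)}$, source map $s$ and range map $r$, such that $r:G\to G^{(0)}$ is a local homeomorphism. Let $G$ be a second countable étale groupoid whose unit space $G^{(0)}$ is compact and totally disconnected. A $G$-set is a subset $U\subset G$ on which $r$ and $s$ are injective; if it is open, put $\tau_U=r\circ(s|_U)^{-1}:s(U)\to r(U)$. The topological full group $[[G]]$ is the group of all homeomorphisms $\gamma$ of $G^{(0)}$ with $\gamma=\tau_U$ for some compact open $G$-set $U$. The groupoid $G$ is principal if every $g\in G$ with $r(g)=s(g)$ is a unit. An elementary subgroupoid is a compact open principal subgroupoid $K\subset G$ containing $G^{(0)}$. For $x\in G^{(0)}$ write $Kx=\{k\in K\mid s(k)=x\}$ $K(x)=r(Kx)$ and, for $C\subset G$, $CKx=\{ck\mid c\in C,\ k\in Kx,\ s(c)=r(k)\}$. The groupoid $G$ is almost finite if for every compact $C\subset G$ and every $\varepsilon>0$ there is an elementary subgroupoid $K\subset G$ with $|CKx\setminus Kx|<\varepsilon\,|K(x)|$ for all $x\in G^{(0)}$. For a locally compact Hausdorff space $Y$ let $C_c(Y,\mathbb{Z})$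 be the group of continuous compactly supported functions $Y\to\mathbb{Z}$, and for a local homeomorphism $\pi:Y\to Z$ let $\pi_*:C_c(Y,\mathbb{Z})\to C_c(Z,\mathbb{Z})$, $\pi_*(f)(z)=\sum_{\pi(y)=z}f(y)$. Let $G^{(2)}=\{(g_1,g_2)\in G\times G\mid s(g_1)=r(g_2)\}$, and let $d_0(g_1,g_2)=g_2$, $d_1(g_1,g_2)=g_1g_2$, $d_2(g_1,g_2)=g_1$. Put $\delta_1=s_*-r_*:C_c(G,\mathbb{Z})\to C_c(G^{(0)},\mathbb{Z})$, $\delta_2=d_{0*}-d_{1*}+d_{2*}:C_c(G^{(2)},\mathbb{Z})\to C_c(G,\mathbb{Z})$ and $H_1(G)=\ker\delta_1/\operatorname{Im}\delta_2$. If $G$ is principal, then for each $\gamma\in[[G]]$ the compact open $G$-set $U$ with $\gamma=\tau_U$ is unique, and the index map is the homomorphism $I:[[G]]\to H_1(G)$, $I(\gamma)=[1_U]$. Let $[[G]]_0$ be the subgroup of $[[G]]$ generated by all elementary homeomorphisms in $[[G]]$, i.e. all $\gamma\in[[G]]$ of finite order such that $\{x\in G^{(0)}\mid\gamma^k(x)=x\}$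 is clopen for every $k\in\mathbb{N}$; it is a normal subgroup. **Corollary 7.13.** Suppose that $G$ is almost finite and principal. Then the kernel of the index map $I$ is equal to $[[G]]_0$, and $[[G]]_0$ is also the subgroup of $[[G]]$ generated by all elements of finite order. Moreover, $I$ induces an isomorphism $[[G]]/[[G]]_0\cong H_1(G)$. -/

import Mathlib

open Set Filter Topology
open scoped CompactlySupported

noncomputable section

/-! ### Compactly supported integer valued functions -/

/-- The characteristic function `1_U` of a compact open set, as an element of `C_c(Y, ℤ)`. -/
def indicatorCc {Y : Type*} [TopologicalSpace Y] [T2Space Y] (U : Set Y)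
    (ho : IsOpen U) (hc : IsCompact U) : C_c(Y, ℤ) where
  toFun := U.indicator (fun _ => 1)
  continuous_toFun :=
    continuous_const.indicator (by
      intro a ha
      rw [IsClopen.frontier_eq ⟨hc.isClosed, ho⟩] at ha
      exact ha.elim)
  hasCompactSupport' := HasCompactSupport.intro hc (fun _ hx => indicator_of_notMem hx _)

theorem finite_fiber_inter_support {Y Z : Type*} [TopologicalSpace Y] [TopologicalSpace Z]
    [T1Space Z] {π : Y → Z} (hπ : IsLocalHomeomorph π) (f : C_c(Y, ℤ)) (z : Z) :
    (π ⁻¹' {z} ∩ Function.support f).Finite := by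
  have h1 : IsCompact (π ⁻¹' {z} ∩ tsupport f) :=
    IsCompact.inter_left f.hasCompactSupport (isClosed_singleton.preimage hπ.continuous)
  have h2 : IsDiscrete (π ⁻¹' {z} ∩ tsupport f) := by
    refine IsLocalHomeomorphOn.isDiscrete_of_image (hπ.isLocalHomeomorphOn) ?_
    refine Set.Subsingleton.isDiscrete ?_
    rintro _ ⟨a, ⟨ha, -⟩, rfl⟩ _ ⟨b, ⟨hb, -⟩, rfl⟩
    rw [mem_preimage, mem_singleton_iff] at ha hb
    rw [ha, hb]
  exact (h1.finite h2).subset (inter_subset_inter_right _ (subset_tsupport _))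

/-- The sum of `f` over the fibre of `π` (a finite sum when `π` is étale). -/
def fiberSum {Y Z : Type*} (π : Y → Z) (f : Y → ℤ) (z : Z) : ℤ :=
  ∑ᶠ y ∈ π ⁻¹' {z}, f y

theorem fiberSum_eventually_eq {Y Z : Type*} [TopologicalSpace Y] [TopologicalSpace Z]
    [T2Space Y] [T2Space Z] {π : Y → Z} (hπ : IsLocalHomeomorph π) (f : C_c(Y, ℤ)) (z₀ : Z) :
    ∀ᶠ z in 𝓝 z₀, fiberSum π f z = fiberSum π f z₀ := by
  classical
  have hfin := finite_fiber_inter_support hπ f z₀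
  set T := hfin.toFinset with hT
  have hTmem : ∀ x, x ∈ T ↔ π x = z₀ ∧ f x ≠ 0 := by
    intro x
    simp [hT]
  choose e hxe hee using hπ
  have hsym : ∀ x ∈ T, Tendsto (e x).symm (𝓝 z₀) (𝓝 x) := by
    intro x hx
    have h1 := (e x).tendsto_symm (hxe x)
    rwa [← hee x, ((hTmem x).1 hx).1] at h1
  have hloc : IsLocallyConstant (f : Y → ℤ) :=
    (IsLocallyConstant.iff_continuous _).2 f.continuous
  have hval : ∀ x ∈ T, ∀ᶠ z in 𝓝 z₀, f ((e x).symm z) = f x := fun x hx =>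
    (hsym x hx).eventually (hloc.eventually_eq x)
  have hsec : ∀ x ∈ T, ∀ᶠ z in 𝓝 z₀, π ((e x).symm z) = z := by
    intro x hx
    have h1 := (e x).eventually_right_inverse' (hxe x)
    rw [← hee x, ((hTmem x).1 hx).1] at h1
    exact h1
  have hne : ∀ x ∈ T, ∀ y ∈ T, x ≠ y → ∀ᶠ z in 𝓝 z₀, (e x).symm z ≠ (e y).symm z := by
    intro x hx y hy hxy
    exact by
      obtain ⟨A, B, hA, hB, hxA, hyB, hAB⟩ := t2_separation hxy
      filter_upwards [(hsym x hx).eventually (hA.mem_nhds hxA),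
        (hsym y hy).eventually (hB.mem_nhds hyB)] with z h1 h2
      exact hAB.ne_of_mem h1 h2
  have hsuppc : IsCompact (Function.support f) := by
    have h1 : IsClosed (Function.support f) :=
      (isClosed_discrete ({0}ᶜ : Set ℤ)).preimage f.continuous
    have h2 := f.hasCompactSupport
    rwa [HasCompactSupport, tsupport, h1.closure_eq] at h2
  have hC : IsCompact (Function.support f \ ⋃ x ∈ T, (e x).source) :=
    hsuppc.diff (isOpen_biUnion fun x _ => (e x).open_source)
  have hπc : Continuous π := by
    rw [continuous_iff_continuousAt]
    intro x
    rw [hee x]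
    exact (e x).continuousAt (hxe x)
  have hev : ∀ᶠ z in 𝓝 z₀, z ∉ π '' (Function.support f \ ⋃ x ∈ T, (e x).source) := by
    refine (hC.image hπc).isClosed.isOpen_compl.mem_nhds ?_
    rintro ⟨y, ⟨hy1, hy2⟩, hy3⟩
    exact hy2 (mem_biUnion ((hTmem y).2 ⟨hy3, hy1⟩) (hxe y))
  have hval' := (Finset.eventually_all T).2 hval
  have hsec' := (Finset.eventually_all T).2 hsec
  have hne' : ∀ᶠ z in 𝓝 z₀, ∀ x ∈ T, ∀ y ∈ T, x ≠ y → (e x).symm z ≠ (e y).symm z := by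
    refine (Finset.eventually_all T).2 fun x hx => (Finset.eventually_all T).2 fun y hy => ?_
    exact eventually_imp_distrib_left.2 (hne x hx y hy)
  filter_upwards [hval', hsec', hne', hev] with z h1 h2 h3 h4
  have hz : fiberSum π f z = ∑ y ∈ T.image (fun x => (e x).symm z), f y := by
    refine finsum_mem_eq_sum_of_inter_support_eq _ ?_
    ext y
    simp only [mem_inter_iff, mem_preimage, mem_singleton_iff, Function.mem_support,
      Finset.coe_image, mem_image, Finset.mem_coe]
    constructor
    · rintro ⟨hy, hfy⟩
      refine ⟨?_, hfy⟩
      by_contra hcon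
      refine h4 ⟨y, ⟨hfy, fun hmem => ?_⟩, hy⟩
      obtain ⟨x, hx, hyx⟩ := mem_iUnion₂.1 hmem
      refine hcon ⟨x, hx, ?_⟩
      rw [← hy, hee x]
      exact (e x).left_inv hyx
    · rintro ⟨⟨x, hx, rfl⟩, hfy⟩
      exact ⟨h2 x hx, hfy⟩
  have hz₀ : fiberSum π f z₀ = ∑ x ∈ T, f x := by
    refine finsum_mem_eq_sum_of_inter_support_eq _ ?_
    ext y
    simp [hTmem]
  rw [hz, hz₀, Finset.sum_image]
  · exact Finset.sum_congr rfl h1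
  · intro x hx y hy hxy
    by_contra hcon
    exact h3 x hx y hy hcon hxy

/-- For an étale map `π : Y → Z`, the homomorphism `π_* : C_c(Y, ℤ) → C_c(Z, ℤ)`,
`π_*(f)(z) = ∑_{π(y) = z} f(y)`. -/
def pushforward {Y Z : Type*} [TopologicalSpace Y] [TopologicalSpace Z]
    [T2Space Y] [T2Space Z] {π : Y → Z} (hπ : IsLocalHomeomorph π) : C_c(Y, ℤ) →+ C_c(Z, ℤ) where
  toFun f :=
    { toFun := fiberSum π f
      continuous_toFun :=
        ((IsLocallyConstant.iff_eventually_eq _).2 (fiberSum_eventually_eq hπ f)).continuous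
      hasCompactSupport' := by
        refine HasCompactSupport.intro (f.hasCompactSupport.image hπ.continuous) ?_
        intro z hz
        refine finsum_mem_eq_zero_of_forall_eq_zero ?_
        intro y hy
        by_contra hcon
        exact hz ⟨y, subset_tsupport _ hcon, hy⟩ }
  map_zero' := by
    ext z
    exact finsum_mem_zero _
  map_add' f g := by
    ext z
    exact finsum_mem_add_distrib' (finite_fiber_inter_support hπ f z)
      (finite_fiber_inter_support hπ g z)

theorem pushforward_apply {Y Z : Type*} [TopologicalSpace Y] [TopologicalSpace Z]
    [T2Space Y] [T2Space Z] {π : Y → Z} (hπ : IsLocalHomeomorph π) (f : C_c(Y, ℤ)) (z : Z) :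
    pushforward hπ f z = ∑ᶠ y ∈ π ⁻¹' {z}, f y := rfl

theorem pushforward_indicatorCc {Y Z : Type*} [TopologicalSpace Y] [TopologicalSpace Z]
    [T2Space Y] [T2Space Z] {π : Y → Z} (hπ : IsLocalHomeomorph π) {U : Set Y}
    (ho : IsOpen U) (hc : IsCompact U) (hinj : InjOn π U) :
    pushforward hπ (indicatorCc U ho hc) =
      indicatorCc (π '' U) (hπ.isOpenMap U ho) (hc.image hπ.continuous) := by
  ext z
  rw [pushforward_apply]
  change ∑ᶠ y ∈ π ⁻¹' {z}, U.indicator (fun _ => (1 : ℤ)) y = (π '' U).indicator (fun _ => 1) z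
  by_cases hz : z ∈ π '' U
  · obtain ⟨x, hx, rfl⟩ := hz
    rw [indicator_of_mem (mem_image_of_mem π hx),
      finsum_mem_eq_sum_of_inter_support_eq _ (t := {x}), Finset.sum_singleton,
      indicator_of_mem hx]
    ext y
    simp only [mem_inter_iff, mem_preimage, mem_singleton_iff, Function.mem_support,
      indicator_apply_ne_zero, Finset.coe_singleton]
    constructor
    · rintro ⟨h1, h2, -⟩
      exact ⟨hinj h2 hx h1, h2, one_ne_zero⟩
    · rintro ⟨rfl, -⟩
      exact ⟨rfl, hx, one_ne_zero⟩
  · rw [indicator_of_notMem hz]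
    refine finsum_mem_eq_zero_of_forall_eq_zero ?_
    intro y hy
    refine indicator_of_notMem (fun hyU => hz ⟨y, hyU, hy⟩) _

/-! ### Étale groupoids -/

/-- An étale groupoid with space of arrows `G` and space of units `X`
(`X` is identified with a subspace of `G` by the embedding `unit`; it is an embedding because
`r` is a continuous left inverse). The product `mul g h` is defined exactly when `s g = r h`.
The locally compact Hausdorff condition is imposed on the spaces `G` and `X` separately. -/
structure EtaleGroupoid (G X : Type*) [TopologicalSpace G] [TopologicalSpace X] where
  /-- source -/
  s : G → X
  /-- range -/
  r : G → X
  /-- inclusion of the unit space -/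
  unit : X → G
  /-- inverse -/
  inv : G → G
  /-- product of composable arrows -/
  mul : ∀ g h : G, s g = r h → G
  s_unit : ∀ x, s (unit x) = x
  r_unit : ∀ x, r (unit x) = x
  s_inv : ∀ g, s (inv g) = r g
  r_inv : ∀ g, r (inv g) = s g
  s_mul : ∀ g h (e : s g = r h), s (mul g h e) = s h
  r_mul : ∀ g h (e : s g = r h), r (mul g h e) = r g
  mul_assoc : ∀ g h k (e : s g = r h) (e' : s h = r k),
    mul (mul g h e) k ((s_mul g h e).trans e') = mul g (mul h k e') (e.trans (r_mul h k e').symm)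
  unit_mul : ∀ g, mul (unit (r g)) g (s_unit (r g)) = g
  mul_unit : ∀ g, mul g (unit (s g)) (r_unit (s g)).symm = g
  inv_mul : ∀ g, mul (inv g) g (s_inv g) = unit (s g)
  mul_inv : ∀ g, mul g (inv g) (r_inv g).symm = unit (r g)
  continuous_unit : Continuous unit
  continuous_inv : Continuous inv
  continuous_mul : Continuous fun p : {p : G × G // s p.1 = r p.2} => mul p.1.1 p.1.2 p.2
  isLocalHomeomorph_r : IsLocalHomeomorph r

namespace EtaleGroupoid

section Basic

variable {G X : Type*} [TopologicalSpace G] [TopologicalSpace X] (𝒢 : EtaleGroupoid G X)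

/-- The space `G⁽²⁾` of composable pairs. -/
abbrev Pairs : Type _ := {p : G × G // 𝒢.s p.1 = 𝒢.r p.2}

/-- `d₀(g₁, g₂) = g₂`. -/
def d₀ (p : 𝒢.Pairs) : G := p.1.2

/-- `d₁(g₁, g₂) = g₁g₂`. -/
def d₁ (p : 𝒢.Pairs) : G := 𝒢.mul p.1.1 p.1.2 p.2

/-- `d₂(g₁, g₂) = g₁`. -/
def d₂ (p : 𝒢.Pairs) : G := p.1.1

theorem inv_inv (g : G) : 𝒢.inv (𝒢.inv g) = g := by
  have h1 := 𝒢.mul_assoc (𝒢.inv (𝒢.inv g)) (𝒢.inv g) g (𝒢.s_inv _) (𝒢.s_inv _)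
  have h2 : ∀ a b (e : 𝒢.s a = 𝒢.r b) (x : X), a = 𝒢.unit x → 𝒢.mul a b e = b := by
    rintro a b e x rfl
    rw [𝒢.s_unit] at e
    subst e
    exact 𝒢.unit_mul b
  have h3 : ∀ a b (e : 𝒢.s a = 𝒢.r b) (x : X), b = 𝒢.unit x → 𝒢.mul a b e = a := by
    rintro a b e x rfl
    rw [𝒢.r_unit] at e
    subst e
    exact 𝒢.mul_unit a
  rw [h2 _ _ _ _ (𝒢.inv_mul _), h3 _ _ _ _ (𝒢.inv_mul g)] at h1
  exact h1.symm

theorem isLocalHomeomorph_s : IsLocalHomeomorph 𝒢.s := by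
  have h : 𝒢.s = 𝒢.r ∘ (⟨⟨𝒢.inv, 𝒢.inv, 𝒢.inv_inv, 𝒢.inv_inv⟩,
      𝒢.continuous_inv, 𝒢.continuous_inv⟩ : G ≃ₜ G) := by
    funext g
    exact (𝒢.r_inv g).symm
  rw [h]
  exact 𝒢.isLocalHomeomorph_r.comp (Homeomorph.isLocalHomeomorph _)

theorem isLocalHomeomorph_d₂ : IsLocalHomeomorph 𝒢.d₂ := by
  rw [isLocalHomeomorph_iff_isOpenEmbedding_restrict]
  intro p
  obtain ⟨e, he, hre⟩ := 𝒢.isLocalHomeomorph_r p.1.2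
  have hr : ∀ g, 𝒢.r g = e g := fun g => congrFun hre g
  have hU : IsOpen {q : 𝒢.Pairs | q.1.2 ∈ e.source} :=
    e.open_source.preimage (continuous_snd.comp continuous_subtype_val)
  have hV : IsOpen {g : G | 𝒢.s g ∈ e.target} :=
    e.open_target.preimage 𝒢.isLocalHomeomorph_s.continuous
  refine ⟨_, hU.mem_nhds he, ?_⟩
  let φ : {q : 𝒢.Pairs | q.1.2 ∈ e.source} ≃ₜ {g : G | 𝒢.s g ∈ e.target} :=
    { toFun := fun q => ⟨q.1.1.1, by
        have h1 := e.map_source q.2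
        rw [← hr, ← q.1.2] at h1
        exact h1⟩
      invFun := fun g => ⟨⟨(g.1, e.symm (𝒢.s g.1)), by
        change 𝒢.s g.1 = 𝒢.r (e.symm (𝒢.s g.1))
        rw [hr, e.right_inv g.2]⟩, e.map_target g.2⟩
      left_inv := by
        rintro ⟨⟨⟨a, b⟩, hab⟩, hb⟩
        have hab' : 𝒢.s a = 𝒢.r b := hab
        have h1 : e.symm (𝒢.s a) = b := by
          rw [hab', hr]
          exact e.left_inv hb
        exact Subtype.ext (Subtype.ext (Prod.ext rfl h1))
      right_inv := by
        rintro ⟨g, hg⟩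
        rfl
      continuous_toFun := by fun_prop
      continuous_invFun := by
        refine Continuous.subtype_mk (Continuous.subtype_mk ?_ _) _
        refine continuous_subtype_val.prodMk ?_
        exact e.continuousOn_symm.comp_continuous
          (𝒢.isLocalHomeomorph_s.continuous.comp continuous_subtype_val) (fun g => g.2) }
  exact hV.isOpenEmbedding_subtypeVal.comp φ.isOpenEmbedding

theorem isLocalHomeomorph_d₁ : IsLocalHomeomorph 𝒢.d₁ := by
  refine IsLocalHomeomorph.of_comp (g := 𝒢.r) ?_ 𝒢.isLocalHomeomorph_r 𝒢.continuous_mul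
  have h : 𝒢.r ∘ 𝒢.d₁ = 𝒢.r ∘ 𝒢.d₂ := by
    funext p
    exact 𝒢.r_mul _ _ _
  rw [h]
  exact 𝒢.isLocalHomeomorph_r.comp 𝒢.isLocalHomeomorph_d₂

theorem isLocalHomeomorph_d₀ : IsLocalHomeomorph 𝒢.d₀ := by
  refine IsLocalHomeomorph.of_comp (g := 𝒢.s) ?_ 𝒢.isLocalHomeomorph_s
    (continuous_snd.comp continuous_subtype_val)
  have h : 𝒢.s ∘ 𝒢.d₀ = 𝒢.s ∘ 𝒢.d₁ := by
    funext p
    exact (𝒢.s_mul _ _ _).symm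
  rw [h]
  exact 𝒢.isLocalHomeomorph_s.comp 𝒢.isLocalHomeomorph_d₁

/-- `G` is principal if its isotropy bundle is the unit space. -/
def IsPrincipal : Prop := {g | 𝒢.r g = 𝒢.s g} = range 𝒢.unit

/-- `G` is essentially principal if the interior of its isotropy bundle is the unit space. -/
def IsEssentiallyPrincipal : Prop := interior {g | 𝒢.r g = 𝒢.s g} = range 𝒢.unit

theorem isOpen_range_unit : IsOpen (range 𝒢.unit) := by
  rw [isOpen_iff_mem_nhds]
  rintro _ ⟨x, rfl⟩
  obtain ⟨e, he, hre⟩ := 𝒢.isLocalHomeomorph_r (𝒢.unit x)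
  have hc : Continuous fun g => 𝒢.unit (𝒢.r g) :=
    𝒢.continuous_unit.comp 𝒢.isLocalHomeomorph_r.continuous
  have h1 : e.source ∩ (fun g => 𝒢.unit (𝒢.r g)) ⁻¹' e.source ∈ 𝓝 (𝒢.unit x) := by
    refine (e.open_source.inter (e.open_source.preimage hc)).mem_nhds ⟨he, ?_⟩
    rw [mem_preimage, 𝒢.r_unit]
    exact he
  filter_upwards [h1] with g hg
  refine ⟨𝒢.r g, e.injOn hg.2 hg.1 ?_⟩
  rw [← hre, 𝒢.r_unit]

theorem IsPrincipal.isEssentiallyPrincipal {𝒢 : EtaleGroupoid G X} (h : 𝒢.IsPrincipal) :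
    𝒢.IsEssentiallyPrincipal := by
  have h' : {g | 𝒢.r g = 𝒢.s g} = range 𝒢.unit := h
  rw [IsEssentiallyPrincipal, h', 𝒢.isOpen_range_unit.interior_eq]

/-! ### Almost finiteness -/

/-- `K ⊆ G` is an elementary subgroupoid: a compact open principal subgroupoid
containing all units. -/
structure IsElementarySubgroupoid (K : Set G) : Prop where
  isCompact : IsCompact K
  isOpen : IsOpen K
  unit_mem : ∀ x, 𝒢.unit x ∈ K
  inv_mem : ∀ g ∈ K, 𝒢.inv g ∈ K
  mul_mem : ∀ g ∈ K, ∀ h ∈ K, ∀ e : 𝒢.s g = 𝒢.r h, 𝒢.mul g h e ∈ K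
  principal : ∀ g ∈ K, 𝒢.r g = 𝒢.s g → g ∈ range 𝒢.unit

/-- The product `UV = {gh | g ∈ U, h ∈ V, s(g) = r(h)}` of two sets of arrows. -/
def mulSet (U V : Set G) : Set G :=
  {k | ∃ g ∈ U, ∃ h ∈ V, ∃ e : 𝒢.s g = 𝒢.r h, 𝒢.mul g h e = k}

/-- `Kx = {k ∈ K | s(k) = x}`. -/
def sourceFiber (K : Set G) (x : X) : Set G := {k ∈ K | 𝒢.s k = x}

/-- The orbit `K(x) = r(Kx)`. -/
def orbit (K : Set G) (x : X) : Set X := 𝒢.r '' 𝒢.sourceFiber K x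

/-- Almost finiteness: for every compact `C ⊆ G` and `ε > 0` there is an elementary subgroupoid
`K` with `|CKx ∖ Kx| / |K(x)| < ε` for all units `x`. (Since `C` and `K` are compact and fibres
of `s` are closed and discrete, both cardinalities are finite, and `K(x)` contains `x`.) -/
def IsAlmostFinite : Prop :=
  ∀ C : Set G, IsCompact C → ∀ ε : ℝ, 0 < ε →
    ∃ K : Set G, 𝒢.IsElementarySubgroupoid K ∧ ∀ x : X,
      ((𝒢.mulSet C (𝒢.sourceFiber K x) \ 𝒢.sourceFiber K x).ncard : ℝ) /
        ((𝒢.orbit K x).ncard : ℝ) < ε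

/-! ### The topological full group -/

/-- `U` is a compact open `G`-set with `s(U) = r(U) = G⁽⁰⁾` and `τ_U = γ`,
where `τ_U = r ∘ (s|U)⁻¹`. -/
structure Implements (U : Set G) (γ : X ≃ₜ X) : Prop where
  isCompact : IsCompact U
  isOpen : IsOpen U
  injOn_s : InjOn 𝒢.s U
  injOn_r : InjOn 𝒢.r U
  image_s : 𝒢.s '' U = univ
  image_r : 𝒢.r '' U = univ
  apply_s : ∀ g ∈ U, γ (𝒢.s g) = 𝒢.r g

theorem mulSet_eq_image (U V : Set G) :
    𝒢.mulSet U V = 𝒢.d₁ '' {p : 𝒢.Pairs | p.1.1 ∈ U ∧ p.1.2 ∈ V} := by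
  ext k
  constructor
  · rintro ⟨g, hg, h, hh, e, rfl⟩
    exact ⟨⟨(g, h), e⟩, ⟨hg, hh⟩, rfl⟩
  · rintro ⟨⟨⟨g, h⟩, e⟩, ⟨hg, hh⟩, rfl⟩
    exact ⟨g, hg, h, hh, e, rfl⟩

theorem isOpen_pairs {U V : Set G} (hU : IsOpen U) (hV : IsOpen V) :
    IsOpen {p : 𝒢.Pairs | p.1.1 ∈ U ∧ p.1.2 ∈ V} :=
  (hU.prod hV).preimage continuous_subtype_val

theorem isCompact_pairs [T2Space X] {U V : Set G} (hU : IsCompact U) (hV : IsCompact V) :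
    IsCompact {p : 𝒢.Pairs | p.1.1 ∈ U ∧ p.1.2 ∈ V} := by
  have h : IsClosed {p : G × G | 𝒢.s p.1 = 𝒢.r p.2} :=
    isClosed_eq (𝒢.isLocalHomeomorph_s.continuous.comp continuous_fst)
      (𝒢.isLocalHomeomorph_r.continuous.comp continuous_snd)
  exact h.isClosedEmbedding_subtypeVal.isCompact_preimage (hU.prod hV)

variable {𝒢}

theorem Implements.one [CompactSpace X] : 𝒢.Implements (range 𝒢.unit) 1 where
  isCompact := isCompact_range 𝒢.continuous_unit
  isOpen := 𝒢.isOpen_range_unit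
  injOn_s := by
    rintro _ ⟨x, rfl⟩ _ ⟨y, rfl⟩ h
    rw [𝒢.s_unit, 𝒢.s_unit] at h
    rw [h]
  injOn_r := by
    rintro _ ⟨x, rfl⟩ _ ⟨y, rfl⟩ h
    rw [𝒢.r_unit, 𝒢.r_unit] at h
    rw [h]
  image_s := eq_univ_of_forall fun x => ⟨_, mem_range_self x, 𝒢.s_unit x⟩
  image_r := eq_univ_of_forall fun x => ⟨_, mem_range_self x, 𝒢.r_unit x⟩
  apply_s := by
    rintro _ ⟨x, rfl⟩
    rw [𝒢.s_unit, 𝒢.r_unit]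
    rfl

theorem Implements.inv {U : Set G} {γ : X ≃ₜ X} (h : 𝒢.Implements U γ) :
    𝒢.Implements (𝒢.inv '' U) γ⁻¹ where
  isCompact := h.isCompact.image 𝒢.continuous_inv
  isOpen := by
    have h1 : 𝒢.inv '' U = 𝒢.inv ⁻¹' U :=
      congrFun (image_eq_preimage_of_inverse 𝒢.inv_inv 𝒢.inv_inv) U
    rw [h1]
    exact h.isOpen.preimage 𝒢.continuous_inv
  injOn_s := by
    rintro _ ⟨a, ha, rfl⟩ _ ⟨b, hb, rfl⟩ hab
    rw [𝒢.s_inv, 𝒢.s_inv] at hab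
    rw [h.injOn_r ha hb hab]
  injOn_r := by
    rintro _ ⟨a, ha, rfl⟩ _ ⟨b, hb, rfl⟩ hab
    rw [𝒢.r_inv, 𝒢.r_inv] at hab
    rw [h.injOn_s ha hb hab]
  image_s := by
    rw [image_image, ← h.image_r]
    exact image_congr fun g _ => 𝒢.s_inv g
  image_r := by
    rw [image_image, ← h.image_s]
    exact image_congr fun g _ => 𝒢.r_inv g
  apply_s := by
    rintro _ ⟨a, ha, rfl⟩
    rw [𝒢.s_inv, 𝒢.r_inv, ← h.apply_s a ha]
    exact γ.symm_apply_apply _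

theorem Implements.mul [T2Space X] {U V : Set G} {γ δ : X ≃ₜ X}
    (hU : 𝒢.Implements U γ) (hV : 𝒢.Implements V δ) : 𝒢.Implements (𝒢.mulSet U V) (γ * δ) where
  isCompact := by
    rw [mulSet_eq_image]
    exact (𝒢.isCompact_pairs hU.isCompact hV.isCompact).image 𝒢.isLocalHomeomorph_d₁.continuous
  isOpen := by
    rw [mulSet_eq_image]
    exact 𝒢.isLocalHomeomorph_d₁.isOpenMap _ (𝒢.isOpen_pairs hU.isOpen hV.isOpen)
  injOn_s := by
    rintro _ ⟨a, ha, b, hb, e, rfl⟩ _ ⟨a', ha', b', hb', e', rfl⟩ h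
    rw [𝒢.s_mul, 𝒢.s_mul] at h
    obtain rfl := hV.injOn_s hb hb' h
    obtain rfl := hU.injOn_s ha ha' (e.trans e'.symm)
    rfl
  injOn_r := by
    rintro _ ⟨a, ha, b, hb, e, rfl⟩ _ ⟨a', ha', b', hb', e', rfl⟩ h
    rw [𝒢.r_mul, 𝒢.r_mul] at h
    obtain rfl := hU.injOn_r ha ha' h
    obtain rfl := hV.injOn_r hb hb' (e.symm.trans e')
    rfl
  image_s := by
    refine eq_univ_of_forall fun x => ?_
    obtain ⟨b, hb, rfl⟩ : x ∈ 𝒢.s '' V := hV.image_s ▸ mem_univ x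
    obtain ⟨a, ha, e⟩ : 𝒢.r b ∈ 𝒢.s '' U := hU.image_s ▸ mem_univ _
    exact ⟨_, ⟨a, ha, b, hb, e, rfl⟩, 𝒢.s_mul _ _ _⟩
  image_r := by
    refine eq_univ_of_forall fun x => ?_
    obtain ⟨a, ha, rfl⟩ : x ∈ 𝒢.r '' U := hU.image_r ▸ mem_univ x
    obtain ⟨b, hb, e⟩ : 𝒢.s a ∈ 𝒢.r '' V := hV.image_r ▸ mem_univ _
    exact ⟨_, ⟨a, ha, b, hb, e.symm, rfl⟩, 𝒢.r_mul _ _ _⟩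
  apply_s := by
    rintro _ ⟨a, ha, b, hb, e, rfl⟩
    rw [𝒢.s_mul, 𝒢.r_mul, ← hU.apply_s a ha, e, ← hV.apply_s b hb]
    rfl

/-- For essentially principal `G` the `G`-set implementing a homeomorphism is unique. -/
theorem Implements.unique [T2Space X] (hG : 𝒢.IsEssentiallyPrincipal) {U V : Set G} {γ : X ≃ₜ X}
    (hU : 𝒢.Implements U γ) (hV : 𝒢.Implements V γ) : U = V := by
  have key : ∀ {U V : Set G}, 𝒢.Implements U γ → 𝒢.Implements V γ → U ⊆ V := by
    intro U V hU hV g hg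
    obtain ⟨h, hh, hs⟩ : 𝒢.s g ∈ 𝒢.s '' V := hV.image_s ▸ mem_univ _
    have hr : 𝒢.r h = 𝒢.r g := by rw [← hV.apply_s h hh, ← hU.apply_s g hg, hs]
    have hW := hV.inv.mul hU
    have hsub : 𝒢.mulSet (𝒢.inv '' V) U ⊆ range 𝒢.unit := by
      rw [← hG]
      refine interior_maximal ?_ hW.isOpen
      intro k hk
      have h1 := hW.apply_s k hk
      rw [inv_mul_cancel] at h1
      exact h1.symm
    have e : 𝒢.s (𝒢.inv h) = 𝒢.r g := (𝒢.s_inv h).trans hr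
    obtain ⟨x, hx⟩ := hsub ⟨𝒢.inv h, ⟨h, hh, rfl⟩, g, hg, e, rfl⟩
    have h1 := 𝒢.mul_assoc h (𝒢.inv h) g (𝒢.r_inv h).symm e
    have hl : ∀ a b (e : 𝒢.s a = 𝒢.r b) (x : X), a = 𝒢.unit x → 𝒢.mul a b e = b := by
      rintro a b e x rfl
      rw [𝒢.s_unit] at e
      subst e
      exact 𝒢.unit_mul b
    have hr' : ∀ a b (e : 𝒢.s a = 𝒢.r b) (x : X), b = 𝒢.unit x → 𝒢.mul a b e = a := by
      rintro a b e x rfl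
      rw [𝒢.r_unit] at e
      subst e
      exact 𝒢.mul_unit a
    rw [hl _ _ _ _ (𝒢.mul_inv h), hr' _ _ _ _ hx.symm] at h1
    rw [h1]
    exact hh
  exact (key hU hV).antisymm (key hV hU)

variable (𝒢)

/-- The topological full group `[[G]]`. -/
def topFullGroup [T2Space X] [CompactSpace X] : Subgroup (X ≃ₜ X) where
  carrier := {γ | ∃ U, 𝒢.Implements U γ}
  mul_mem' := by
    rintro γ δ ⟨U, hU⟩ ⟨V, hV⟩
    exact ⟨_, hU.mul hV⟩
  one_mem' := ⟨_, Implements.one⟩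
  inv_mem' := by
    rintro γ ⟨U, hU⟩
    exact ⟨_, hU.inv⟩

end Basic

/-- A homeomorphism is elementary if it is of finite order and, for every `k`, the set of fixed
points of its `k`-th power is clopen. -/
def IsElementaryHomeo {X : Type*} [TopologicalSpace X] (γ : X ≃ₜ X) : Prop :=
  IsOfFinOrder γ ∧ ∀ k : ℕ, IsClopen {x | (γ ^ k) x = x}

theorem IsElementaryHomeo.conj {X : Type*} [TopologicalSpace X] {γ : X ≃ₜ X}
    (h : IsElementaryHomeo γ) (g : X ≃ₜ X) : IsElementaryHomeo (g * γ * g⁻¹) := by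
  refine ⟨(MulAut.conj g).toMonoidHom.isOfFinOrder h.1, fun k => ?_⟩
  have h1 : {x | ((g * γ * g⁻¹) ^ k) x = x} = g.symm ⁻¹' {x | (γ ^ k) x = x} := by
    ext x
    rw [conj_pow]
    change g ((γ ^ k) (g.symm x)) = x ↔ (γ ^ k) (g.symm x) = g.symm x
    exact (g.toEquiv.eq_symm_apply).symm
  rw [h1]
  exact (h.2 k).preimage g.symm.continuous

section Homology

variable {G X : Type*} [TopologicalSpace G] [TopologicalSpace X] [T2Space G] [T2Space X]
  (𝒢 : EtaleGroupoid G X)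

/-- The subgroup `[[G]]₀` of `[[G]]` generated by the elementary homeomorphisms in `[[G]]`. -/
def elementarySubgroup [CompactSpace X] : Subgroup 𝒢.topFullGroup :=
  Subgroup.closure {γ | IsElementaryHomeo (γ : X ≃ₜ X)}

instance [CompactSpace X] : 𝒢.elementarySubgroup.Normal := by
  refine ⟨fun n hn g => ?_⟩
  have h : 𝒢.elementarySubgroup ≤
      𝒢.elementarySubgroup.comap (MulAut.conj g).toMonoidHom :=
    (Subgroup.closure_le _).2 fun γ hγ =>
      Subgroup.subset_closure (IsElementaryHomeo.conj hγ (g : X ≃ₜ X))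
  exact h hn

/-- `δ₁ = s_* - r_*`. -/
def δ₁ : C_c(G, ℤ) →+ C_c(X, ℤ) :=
  pushforward 𝒢.isLocalHomeomorph_s - pushforward 𝒢.isLocalHomeomorph_r

/-- `δ₂ = d₀_* - d₁_* + d₂_*`. -/
def δ₂ : C_c(𝒢.Pairs, ℤ) →+ C_c(G, ℤ) :=
  pushforward 𝒢.isLocalHomeomorph_d₀ - pushforward 𝒢.isLocalHomeomorph_d₁ +
    pushforward 𝒢.isLocalHomeomorph_d₂

/-- The first homology group `H₁(G) = ker δ₁ / im δ₂` with integer coefficients. -/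
abbrev H₁ : Type _ := 𝒢.δ₁.ker ⧸ 𝒢.δ₂.range.addSubgroupOf 𝒢.δ₁.ker

variable {𝒢}

theorem Implements.indicator_mem_ker {U : Set G} {γ : X ≃ₜ X} (h : 𝒢.Implements U γ) :
    indicatorCc U h.isOpen h.isCompact ∈ 𝒢.δ₁.ker := by
  rw [AddMonoidHom.mem_ker, δ₁, AddMonoidHom.sub_apply,
    pushforward_indicatorCc _ _ _ h.injOn_s, pushforward_indicatorCc _ _ _ h.injOn_r, sub_eq_zero]
  congr 1
  rw [h.image_s, h.image_r]

/-- The class `[1_U] ∈ H₁(G)` of a compact open `G`-set `U` with `τ_U = γ`. -/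
def Implements.homologyClass {U : Set G} {γ : X ≃ₜ X} (h : 𝒢.Implements U γ) : 𝒢.H₁ :=
  QuotientAddGroup.mk ⟨indicatorCc U h.isOpen h.isCompact, h.indicator_mem_ker⟩

theorem Implements.homologyClass_mul {U V : Set G} {γ δ : X ≃ₜ X}
    (hU : 𝒢.Implements U γ) (hV : 𝒢.Implements V δ) :
    (hU.mul hV).homologyClass = hU.homologyClass + hV.homologyClass := by
  have ho := 𝒢.isOpen_pairs hU.isOpen hV.isOpen
  have hc := 𝒢.isCompact_pairs hU.isCompact hV.isCompact
  refine (QuotientAddGroup.eq).2 ?_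
  rw [AddSubgroup.mem_addSubgroupOf]
  refine ⟨indicatorCc _ ho hc, ?_⟩
  have i₀ : InjOn 𝒢.d₀ {p : 𝒢.Pairs | p.1.1 ∈ U ∧ p.1.2 ∈ V} := by
    rintro ⟨⟨a, b⟩, e⟩ ⟨ha, -⟩ ⟨⟨a', b'⟩, e'⟩ ⟨ha', -⟩ h
    change b = b' at h
    subst h
    have e1 : 𝒢.s a = 𝒢.r b := e
    have e2 : 𝒢.s a' = 𝒢.r b := e'
    obtain rfl : a = a' := hU.injOn_s ha ha' (e1.trans e2.symm)
    rfl
  have i₂ : InjOn 𝒢.d₂ {p : 𝒢.Pairs | p.1.1 ∈ U ∧ p.1.2 ∈ V} := by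
    rintro ⟨⟨a, b⟩, e⟩ ⟨-, hb⟩ ⟨⟨a', b'⟩, e'⟩ ⟨-, hb'⟩ h
    change a = a' at h
    subst h
    have e1 : 𝒢.s a = 𝒢.r b := e
    have e2 : 𝒢.s a = 𝒢.r b' := e'
    obtain rfl : b = b' := hV.injOn_r hb hb' (e1.symm.trans e2)
    rfl
  have i₁ : InjOn 𝒢.d₁ {p : 𝒢.Pairs | p.1.1 ∈ U ∧ p.1.2 ∈ V} := by
    rintro ⟨⟨a, b⟩, e⟩ ⟨ha, hb⟩ ⟨⟨a', b'⟩, e'⟩ ⟨ha', hb'⟩ h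
    have h1 := congrArg 𝒢.r h
    have h2 := congrArg 𝒢.s h
    rw [d₁, d₁, 𝒢.r_mul, 𝒢.r_mul] at h1
    rw [d₁, d₁, 𝒢.s_mul, 𝒢.s_mul] at h2
    obtain rfl : a = a' := hU.injOn_r ha ha' h1
    obtain rfl : b = b' := hV.injOn_s hb hb' h2
    rfl
  have m₀ : 𝒢.d₀ '' {p : 𝒢.Pairs | p.1.1 ∈ U ∧ p.1.2 ∈ V} = V := by
    refine Subset.antisymm ?_ fun b hb => ?_
    · rintro _ ⟨p, hp, rfl⟩
      exact hp.2
    · obtain ⟨a, ha, e⟩ : 𝒢.r b ∈ 𝒢.s '' U := hU.image_s ▸ mem_univ _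
      exact ⟨⟨(a, b), e⟩, ⟨ha, hb⟩, rfl⟩
  have m₂ : 𝒢.d₂ '' {p : 𝒢.Pairs | p.1.1 ∈ U ∧ p.1.2 ∈ V} = U := by
    refine Subset.antisymm ?_ fun a ha => ?_
    · rintro _ ⟨p, hp, rfl⟩
      exact hp.1
    · obtain ⟨b, hb, e⟩ : 𝒢.s a ∈ 𝒢.r '' V := hV.image_r ▸ mem_univ _
      exact ⟨⟨(a, b), e.symm⟩, ⟨ha, hb⟩, rfl⟩
  have m₁ := (𝒢.mulSet_eq_image U V).symm
  have key : ∀ {A B : Set G} (hA : IsOpen A) (hA' : IsCompact A) (hB : IsOpen B)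
      (hB' : IsCompact B), A = B → indicatorCc A hA hA' = indicatorCc B hB hB' := by
    rintro A B _ _ _ _ rfl
    rfl
  rw [δ₂, AddMonoidHom.add_apply, AddMonoidHom.sub_apply, pushforward_indicatorCc _ _ _ i₀,
    pushforward_indicatorCc _ _ _ i₁, pushforward_indicatorCc _ _ _ i₂,
    key _ _ hV.isOpen hV.isCompact m₀, key _ _ hU.isOpen hU.isCompact m₂,
    key _ _ (hU.mul hV).isOpen (hU.mul hV).isCompact m₁]
  simp only [AddSubgroup.coe_add, NegMemClass.coe_neg]
  abel

theorem Implements.homologyClass_congr {U V : Set G} {γ δ : X ≃ₜ X} (hU : 𝒢.Implements U γ)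
    (hV : 𝒢.Implements V δ) (h : U = V) : hU.homologyClass = hV.homologyClass := by
  subst h
  rfl

variable (𝒢)

/-- The index map `I : [[G]] → H₁(G)` of an essentially principal étale groupoid:
`I(γ) = [1_U]`, where `U` is the unique compact open `G`-set with `τ_U = γ`.
(The group `H₁(G)` is written multiplicatively.) -/
def indexMap [CompactSpace X] (hG : 𝒢.IsEssentiallyPrincipal) :
    𝒢.topFullGroup →* Multiplicative 𝒢.H₁ :=
  MonoidHom.mk' (fun γ => Multiplicative.ofAdd γ.2.choose_spec.homologyClass) (by
    intro γ δ
    rw [← ofAdd_add, ← Implements.homologyClass_mul]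
    exact congrArg _ (Implements.homologyClass_congr _ _
      (Implements.unique hG (γ * δ).2.choose_spec
        (γ.2.choose_spec.mul δ.2.choose_spec))))

theorem indexMap_apply [CompactSpace X] (hG : 𝒢.IsEssentiallyPrincipal) (γ : 𝒢.topFullGroup)
    {U : Set G} (hU : 𝒢.Implements U γ) :
    𝒢.indexMap hG γ = Multiplicative.ofAdd hU.homologyClass :=
  congrArg Multiplicative.ofAdd
    (Implements.homologyClass_congr γ.2.choose_spec hU (Implements.unique hG γ.2.choose_spec hU))

end Homology

end EtaleGroupoid

end

/-!
# The index map of an almost finite principal étale groupoid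

An arrow of a principal groupoid is determined by its source and its range, and this makes a
combinatorial proof possible. An elementary subgroupoid `K` partitions the unit space into finite
classes, and has a section `c` picking a representative of each class together with arrows to all
its members (`OrbitSection`, `IsElementarySubgroupoid.exists_orbitSection`). Transporting arrows to
the representatives turns a function on `G` into *crossing data*, counting the arrows from each
class to each other class (`OrbitSection.reduce`). Two facts make crossing data decisive:

* a `1`-cycle without crossing data is a boundary (`OrbitSection.mem_range_δ₂`, a chain homotopy);
* elements of the full group with the same crossing data agree up to multiplication, on both sides,
  by homeomorphisms preserving the classes, which have finite order
  (`OrbitSection.exists_double_coset`).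

Almost finiteness says that `K` can be chosen so that, for a prescribed function, the number of
crossing arrows issuing from a class is at most the size of the class
(`IsAlmostFinite.exists_orbitSection`). Hence crossing arrows can be moved, within their classes,
to have distinct sources, and any bijection along which such a family of arrows is composable is
realized by an element of the full group with the same crossing data
(`OrbitSection.exists_placement`, `OrbitSection.reduce_cycle_extendHomeo`). All choices of this kind
are made continuously by a single matching lemma for étale spaces over a totally disconnected base
(`exists_injective_lift`).

*Surjectivity.* A nonnegative cycle has, for each class, as many crossing arrows leaving as
arriving. Matching arrivals with departures realizes it by an element of the full group, and cycles
are differences of nonnegative ones.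

*Kernel.* An element of finite order generates an elementary subgroupoid, for which it has no
crossing data, so its index vanishes. Conversely let `1_U = δ₂ f`. Every composable pair `(a, b)`
gives a triangle with sides `b`, `a`, `(ab)⁻¹`, and the sides of a family of triangles are realized
by a homeomorphism of order three. Up to classes, the boundary of a pair is the difference of its
triangle and of the degenerate triangle `ab`, unit, `(ab)⁻¹`. So `U` together with one family of
triangles has the same crossing data as another family. Realizing the first family away from the
crossing arrows of `U` exhibits the element implemented by `U` as a product of elements of finite
order.

In a principal groupoid elements of finite order in the full group are elementary, because the unit
space is clopen in `G`; so the two descriptions of `[[G]]₀` agree.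
-/

noncomputable section

/-! ### Matching étale spaces over a totally disconnected base -/

section Matching

variable {E A B : Type*} [TopologicalSpace E] [TopologicalSpace A] [TopologicalSpace B]

theorem Set.MapsTo.surjOn_of_injOn_of_ncard_le {α β : Type*} {f : α → β} {S : Set α} {T : Set β}
    (hf : MapsTo f S T) (hinj : InjOn f S) (h : T.ncard ≤ S.ncard) (hT : T.Finite) :
    SurjOn f S T :=
  (eq_of_subset_of_ncard_le hf.image_subset (by rwa [hinj.ncard_image]) hT).ge

theorem isLocalHomeomorph_id :
    IsLocalHomeomorph (id : E → E) :=
  IsOpenEmbedding.id.isLocalHomeomorph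

theorem IsLocalHomeomorph.isDiscrete_fiber [T1Space B] {p : E → B} (hp : IsLocalHomeomorph p)
    (b : B) : IsDiscrete (p ⁻¹' {b}) := by
  refine IsLocalHomeomorphOn.isDiscrete_of_image hp.isLocalHomeomorphOn ?_
  exact (subsingleton_singleton.anti (image_preimage_subset p {b})).isDiscrete

theorem IsLocalHomeomorph.finite_fiber [CompactSpace E] [T1Space B] {p : E → B}
    (hp : IsLocalHomeomorph p) (b : B) : (p ⁻¹' {b}).Finite :=
  ((isClosed_singleton.preimage hp.continuous).isCompact).finite (hp.isDiscrete_fiber b)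

theorem IsLocalHomeomorph.totallyDisconnectedSpace [T1Space B] [TotallyDisconnectedSpace B]
    {p : E → B} (hp : IsLocalHomeomorph p) : TotallyDisconnectedSpace E := by
  refine ⟨fun S _ hS => ?_⟩
  rcases S.eq_empty_or_nonempty with rfl | ⟨x, hx⟩
  · exact subsingleton_empty
  have h1 : (p '' S).Subsingleton := (hS.image p hp.continuous.continuousOn).subsingleton
  have h2 : S ⊆ p ⁻¹' {p x} := fun y hy => h1 (mem_image_of_mem p hy) (mem_image_of_mem p hx)
  have h3 : IsDiscrete S := (hp.isDiscrete_fiber (p x)).mono h2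
  exact hS.isDiscrete_iff_subsingleton.1 h3

theorem IsLocalHomeomorph.exists_isOpen_injOn {p : E → B} (hp : IsLocalHomeomorph p) (x : E) :
    ∃ W, IsOpen W ∧ x ∈ W ∧ InjOn p W := by
  obtain ⟨e, he, rfl⟩ := hp x
  exact ⟨e.source, e.open_source, he, e.injOn⟩

/-- If a relation on a compact totally disconnected space is locally contained in the diagonal,
then some continuous labelling by natural numbers separates related points. -/
theorem exists_continuous_label [CompactSpace E] [T2Space E] [TotallyDisconnectedSpace E]
    (R : E → E → Prop)
    (hR : ∀ e, ∃ W, IsOpen W ∧ e ∈ W ∧ ∀ x ∈ W, ∀ y ∈ W, R x y → x = y) :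
    ∃ l : E → ℕ, Continuous l ∧ ∀ x y, R x y → l x = l y → x = y := by
  classical
  choose W hWo hWe hW using hR
  have h1 : ∀ e, ∃ V, IsClopen V ∧ e ∈ V ∧ V ⊆ W e := fun e =>
    compact_exists_isClopen_in_isOpen (hWo e) (hWe e)
  choose V hVc hVe hVW using h1
  obtain ⟨T, hT⟩ := isCompact_univ.elim_finite_subcover V (fun e => (hVc e).isOpen)
    (fun e _ => mem_iUnion.2 ⟨e, hVe e⟩)
  let F : E → T → Bool := fun x e => decide (x ∈ V e)
  have hF : Continuous F := by
    refine continuous_pi fun e => ?_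
    refine (continuous_bool_rng true).2 ?_
    convert hVc e using 1
    ext x
    simp [F]
  refine ⟨fun x => Finite.equivFin (T → Bool) (F x), ?_, fun x y hxy hl => ?_⟩
  · exact (continuous_of_discreteTopology
      (f := fun a => ((Finite.equivFin (T → Bool) a : Fin _) : ℕ))).comp hF
  · have hFxy : F x = F y := (Finite.equivFin (T → Bool)).injective (Fin.ext hl)
    obtain ⟨e, heT, hxe⟩ := mem_iUnion₂.1 (hT (mem_univ x))
    have hye : y ∈ V e := by
      have := congrFun hFxy ⟨e, heT⟩
      simpa [F, hxe] using this
    exact hW e x (hVW e hxe) y (hVW e hye) hxy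

/-- Over a Hausdorff base, a compact totally disconnected étale space carries a continuous rank
function, which enumerates every fibre as `0, 1, …, n - 1`. -/
theorem IsLocalHomeomorph.exists_rank [CompactSpace E] [T2Space E] [TotallyDisconnectedSpace E]
    [T2Space B] {p : E → B} (hp : IsLocalHomeomorph p) :
    ∃ ρ : E → ℕ, Continuous ρ ∧ ∀ b, BijOn ρ (p ⁻¹' {b}) (Iio (p ⁻¹' {b}).ncard) := by
  classical
  obtain ⟨l, hlc, hl⟩ := exists_continuous_label (fun x y : E => p x = p y) (fun e => by
    obtain ⟨W, h1, h2, h3⟩ := hp.exists_isOpen_injOn e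
    exact ⟨W, h1, h2, fun x hx y hy h => h3 hx hy h⟩)
  let S : ℕ → Set B := fun i => p '' (l ⁻¹' {i})
  have hS : ∀ i, IsClopen (S i) := fun i => by
    have h1 : IsClopen (l ⁻¹' {i}) := (isClopen_discrete _).preimage hlc
    exact ⟨(h1.isClosed.isCompact.image hp.continuous).isClosed, hp.isOpenMap _ h1.isOpen⟩
  let ρ : E → ℕ := fun e => ((Finset.range (l e)).filter (fun i => p e ∈ S i)).card
  have hρ : ∀ e, ρ e = ((Finset.range (l e)).filter (fun i => p e ∈ S i)).card := fun _ => rfl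
  have hlt : ∀ x y, p x = p y → l x < l y → ρ x < ρ y := by
    intro x y hxy hlxy
    refine Finset.card_lt_card ((Finset.ssubset_iff_of_subset ?_).2 ⟨l x, ?_, ?_⟩)
    · intro i hi
      rw [Finset.mem_filter, Finset.mem_range] at hi ⊢
      exact ⟨hi.1.trans hlxy, hxy ▸ hi.2⟩
    · rw [Finset.mem_filter, Finset.mem_range]
      exact ⟨hlxy, x, rfl, hxy⟩
    · simp
  have hinj : ∀ b, InjOn ρ (p ⁻¹' {b}) := by
    intro b x hx y hy hxy
    have hpxy : p x = p y := by rw [mem_preimage, mem_singleton_iff] at hx hy; rw [hx, hy]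
    rcases lt_trichotomy (l x) (l y) with h | h | h
    · exact absurd hxy (hlt x y hpxy h).ne
    · exact hl x y hpxy h
    · exact absurd hxy (hlt y x hpxy.symm h).ne'
  refine ⟨ρ, ?_, fun b => ?_⟩
  · refine continuous_discrete_rng.2 fun n => ?_
    rw [isOpen_iff_mem_nhds]
    intro e he
    have h1 : ∀ᶠ x in 𝓝 e, l x = l e :=
      ((IsLocallyConstant.iff_continuous l).2 hlc).eventually_eq e
    have h2 : ∀ᶠ x in 𝓝 e, ∀ i ∈ Finset.range (l e), (p x ∈ S i ↔ p e ∈ S i) := by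
      refine (Finset.eventually_all _).2 fun i _ => ?_
      by_cases hi : p e ∈ S i
      · filter_upwards [((hS i).isOpen.preimage hp.continuous).mem_nhds hi] with x hx
        exact iff_of_true hx hi
      · filter_upwards [((hS i).compl.isOpen.preimage hp.continuous).mem_nhds hi] with x hx
        exact iff_of_false hx hi
    filter_upwards [h1, h2] with x hx1 hx2
    rw [mem_preimage, mem_singleton_iff] at he ⊢
    rw [← he, hρ, hρ, hx1, Finset.filter_congr hx2]
  · have hfin := hp.finite_fiber b
    have hmaps : MapsTo ρ (p ⁻¹' {b}) (Iio (p ⁻¹' {b}).ncard) := by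
      intro e he
      -- distinct labels below `l e` occurring in the fibre come from distinct points `≠ e`
      have h1 : (((Finset.range (l e)).filter (fun i => p e ∈ S i) : Finset ℕ) : Set ℕ) ⊆
          l '' (p ⁻¹' {b} \ {e}) := by
        intro i hi
        rw [Finset.mem_coe, Finset.mem_filter, Finset.mem_range] at hi
        obtain ⟨x, hx, hxe⟩ := hi.2
        refine ⟨x, ⟨hxe.trans he, ?_⟩, hx⟩
        rintro rfl
        exact hi.1.ne hx.symm
      rw [mem_Iio, hρ, ← ncard_coe_finset]
      calc _ ≤ (l '' (p ⁻¹' {b} \ {e})).ncard := ncard_le_ncard h1 ((hfin.sdiff).image l)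
        _ ≤ (p ⁻¹' {b} \ {e}).ncard := ncard_image_le hfin.sdiff
        _ < _ := ncard_sdiff_singleton_lt_of_mem he hfin
    refine ⟨hmaps, hinj b, ?_⟩
    refine hmaps.surjOn_of_injOn_of_ncard_le (hinj b) ?_ (finite_Iio _)
    rw [ncard_eq_toFinset_card' (Iio _)]
    simp

/-- **Matching lemma.** Over a totally disconnected base, a compact étale space all of whose fibres
are at most as large as those of a second one embeds into it over the base: send a point to the
point of the same rank. -/
theorem exists_injective_lift [CompactSpace E] [T2Space E] [CompactSpace A] [T2Space A]
    [T2Space B] [TotallyDisconnectedSpace B] {p : E → B} {p' : A → B}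
    (hp : IsLocalHomeomorph p) (hp' : IsLocalHomeomorph p')
    (h : ∀ b, (p ⁻¹' {b}).ncard ≤ (p' ⁻¹' {b}).ncard) :
    ∃ θ : E → A, IsOpenEmbedding θ ∧ ∀ e, p' (θ e) = p e := by
  have := hp.totallyDisconnectedSpace
  have := hp'.totallyDisconnectedSpace
  obtain ⟨ρ, hρc, hρ⟩ := hp.exists_rank
  obtain ⟨ρ', hρc', hρ'⟩ := hp'.exists_rank
  have h1 : ∀ e, ∃ a, p' a = p e ∧ ρ' a = ρ e := fun e => by
    have h2 : ρ e ∈ Iio (p' ⁻¹' {p e}).ncard :=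
      lt_of_lt_of_le ((hρ (p e)).mapsTo rfl) (h (p e))
    obtain ⟨a, ha, hae⟩ := (hρ' (p e)).surjOn h2
    exact ⟨a, ha, hae⟩
  choose θ hθ hθρ using h1
  have hinj : Function.Injective θ := fun x y hxy => by
    refine (hρ (p y)).injOn ?_ rfl ?_
    · rw [mem_preimage, mem_singleton_iff, ← hθ x, hxy, hθ y]
    · rw [← hθρ x, hxy, hθρ y]
  have hemb : IsClosedEmbedding fun a => (p' a, ρ' a) := by
    refine (hp'.continuous.prodMk hρc').isClosedEmbedding fun x y hxy => ?_
    rw [Prod.mk.injEq] at hxy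
    exact (hρ' (p' y)).injOn hxy.1 rfl hxy.2
  have hcont : Continuous θ := by
    rw [hemb.isInducing.continuous_iff]
    convert hp.continuous.prodMk hρc using 1
    funext e
    exact Prod.ext (hθ e) (hθρ e)
  have hloc : IsLocalHomeomorph θ := by
    refine IsLocalHomeomorph.of_comp (g := p') ?_ hp' hcont
    rwa [show p' ∘ θ = p from funext hθ]
  exact ⟨θ, hloc.isOpenEmbedding_of_injective hinj, hθ⟩

theorem exists_homeomorph_lift [CompactSpace E] [T2Space E] [CompactSpace A] [T2Space A]
    [T2Space B] [TotallyDisconnectedSpace B] {p : E → B} {p' : A → B}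
    (hp : IsLocalHomeomorph p) (hp' : IsLocalHomeomorph p')
    (h : ∀ b, (p ⁻¹' {b}).ncard = (p' ⁻¹' {b}).ncard) :
    ∃ θ : E ≃ₜ A, ∀ e, p' (θ e) = p e := by
  obtain ⟨θ, hθ, hpθ⟩ := exists_injective_lift hp hp' fun b => (h b).le
  have hsurj : Function.Surjective θ := fun a => by
    have h1 : MapsTo θ (p ⁻¹' {p' a}) (p' ⁻¹' {p' a}) := fun e he => (hpθ e).trans he
    obtain ⟨e, -, he⟩ := h1.surjOn_of_injOn_of_ncard_le hθ.injective.injOn (h (p' a)).ge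
      (hp'.finite_fiber _) (show a ∈ p' ⁻¹' {p' a} from rfl)
    exact ⟨e, he⟩
  exact ⟨hθ.toHomeomorphOfSurjective hsurj, hpθ⟩

theorem IsLocalHomeomorph.isLocalHomeomorphOn_range {f : A → B} {i : E → A}
    (hi : IsLocalHomeomorph i) (hf : IsLocalHomeomorph (f ∘ i)) :
    IsLocalHomeomorphOn f (range i) := by
  rw [← image_univ]
  exact hf.isLocalHomeomorphOn.of_comp_right hi.isLocalHomeomorphOn

theorem IsLocalHomeomorph.sumElim {f : E → B} {g : A → B} (hf : IsLocalHomeomorph f)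
    (hg : IsLocalHomeomorph g) : IsLocalHomeomorph (Sum.elim f g) := by
  have h1 := IsOpenEmbedding.inl.isLocalHomeomorph.isLocalHomeomorphOn_range
    (f := Sum.elim f g) (i := (Sum.inl : E → E ⊕ A)) (by rwa [Sum.elim_comp_inl])
  have h2 := IsOpenEmbedding.inr.isLocalHomeomorph.isLocalHomeomorphOn_range
    (f := Sum.elim f g) (i := (Sum.inr : A → E ⊕ A)) (by rwa [Sum.elim_comp_inr])
  rintro (x | x)
  · exact h1 _ (mem_range_self x)
  · exact h2 _ (mem_range_self x)

theorem IsLocalHomeomorph.of_prod_discrete {D : Type*} [TopologicalSpace D] [DiscreteTopology D]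
    {f : E × D → B} (hf : ∀ d, IsLocalHomeomorph fun e => f (e, d)) : IsLocalHomeomorph f := by
  rintro ⟨e, d⟩
  have h : IsOpenEmbedding fun e : E => (e, d) := by
    refine .of_continuous_injective_isOpenMap (by fun_prop) (fun x y h => (Prod.ext_iff.1 h).1) ?_
    intro U hU
    have h1 : (fun e : E => (e, d)) '' U = U ×ˢ {d} := by
      ext ⟨a, b⟩
      simp [eq_comm]
    rw [h1]
    exact hU.prod (isOpen_discrete _)
  exact h.isLocalHomeomorph.isLocalHomeomorphOn_range (hf d) _ (mem_range_self e)

theorem IsLocalHomeomorph.fst_of_discrete {D : Type*} [TopologicalSpace D] [DiscreteTopology D] :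
    IsLocalHomeomorph (Prod.fst : E × D → E) :=
  .of_prod_discrete fun _ => IsOpenEmbedding.id.isLocalHomeomorph

end Matching

/-! ### Calculus of pushforwards -/

section Pushforward

variable {Y Z V : Type*} [TopologicalSpace Y] [TopologicalSpace Z] [TopologicalSpace V]

/-- The restriction of a compactly supported function to a clopen set, extended by zero. -/
def restrictCc (S : Set Y) (hS : IsClopen S) : C_c(Y, ℤ) →+ C_c(Y, ℤ) where
  toFun f :=
    { toFun := S.indicator f
      continuous_toFun := f.continuous.indicator (by simp [hS.frontier_eq])
      hasCompactSupport' := f.hasCompactSupport.mono fun x hx => by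
        rw [Function.mem_support, indicator_apply_ne_zero] at hx
        exact hx.2 }
  map_zero' := by
    ext x
    simp
  map_add' f g := by
    ext x
    exact congrFun (indicator_add' S f g) x

theorem restrictCc_apply (S : Set Y) (hS : IsClopen S) (f : C_c(Y, ℤ)) (x : Y) :
    restrictCc S hS f x = S.indicator f x := rfl

theorem restrictCc_nonneg (S : Set Y) (hS : IsClopen S) {f : C_c(Y, ℤ)} (hf : 0 ≤ f) :
    0 ≤ restrictCc S hS f :=
  fun _ => indicator_nonneg (fun y _ => hf y) _

theorem restrictCc_restrictCc (S : Set Y) (hS : IsClopen S) (f : C_c(Y, ℤ)) :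
    restrictCc S hS (restrictCc S hS f) = restrictCc S hS f := by
  ext x
  simp only [restrictCc_apply]
  by_cases hx : x ∈ S <;> simp [hx, restrictCc_apply]

theorem restrictCc_le (S : Set Y) (hS : IsClopen S) {f : C_c(Y, ℤ)} (hf : 0 ≤ f) :
    restrictCc S hS f ≤ f :=
  fun x => indicator_le_self' (fun _ _ => hf x) x

/-- The constant function `1` on a compact space. -/
def oneCc (Y : Type*) [TopologicalSpace Y] [T2Space Y] [CompactSpace Y] : C_c(Y, ℤ) :=
  indicatorCc univ isOpen_univ isCompact_univ

theorem oneCc_apply [T2Space Y] [CompactSpace Y] (y : Y) : oneCc Y y = 1 :=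
  indicator_of_mem (mem_univ y) (fun _ => (1 : ℤ))

/-- The étale space over `Y` whose fibre over `y` has `f y` points (none when `f y ≤ 0`). -/
abbrev Layers (f : C_c(Y, ℤ)) : Type _ := {p : Y × ℕ // (p.2 : ℤ) < f p.1}

theorem isOpen_layers (f : C_c(Y, ℤ)) : IsOpen {p : Y × ℕ | (p.2 : ℤ) < f p.1} := by
  have h : Continuous fun p : Y × ℕ => ((p.2 : ℤ), f p.1) :=
    (continuous_of_discreteTopology.comp continuous_snd).prodMk
      (f.continuous.comp continuous_fst)
  exact (isOpen_discrete {q : ℤ × ℤ | q.1 < q.2}).preimage h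

instance (f : C_c(Y, ℤ)) : CompactSpace (Layers f) := by
  refine isCompact_iff_compactSpace.1 (?_ : IsCompact {p : Y × ℕ | (p.2 : ℤ) < f p.1})
  have hclosed : IsClosed {p : Y × ℕ | (p.2 : ℤ) < f p.1} := by
    have h : Continuous fun p : Y × ℕ => ((p.2 : ℤ), f p.1) :=
      (continuous_of_discreteTopology.comp continuous_snd).prodMk
        (f.continuous.comp continuous_fst)
    exact (isClosed_discrete {q : ℤ × ℤ | q.1 < q.2}).preimage h
  obtain ⟨M, hM⟩ := (f.hasCompactSupport.isCompact_range f.continuous).bddAbove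
  refine (f.hasCompactSupport.prod (finite_Iio M.toNat).isCompact).of_isClosed_subset hclosed ?_
  rintro ⟨y, n⟩ (h : (n : ℤ) < f y)
  refine ⟨subset_tsupport _ (show f y ≠ 0 by omega), ?_⟩
  have := hM (mem_range_self y)
  rw [mem_Iio]
  omega

theorem isLocalHomeomorph_layers (f : C_c(Y, ℤ)) :
    IsLocalHomeomorph fun p : Layers f => p.1.1 :=
  IsLocalHomeomorph.fst_of_discrete.comp
    (isOpen_layers f).isOpenEmbedding_subtypeVal.isLocalHomeomorph

variable [T2Space Y] [T2Space Z] [T2Space V]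

theorem pushforward_congr {π π' : Y → Z} (hπ : IsLocalHomeomorph π) (hπ' : IsLocalHomeomorph π')
    {f : C_c(Y, ℤ)} (h : ∀ y, f y ≠ 0 → π y = π' y) : pushforward hπ f = pushforward hπ' f := by
  ext z
  rw [pushforward_apply, pushforward_apply, ← finsum_mem_inter_support,
    ← finsum_mem_inter_support f (π' ⁻¹' {z})]
  refine finsum_mem_congr ?_ fun _ _ => rfl
  ext y
  simp only [mem_inter_iff, mem_preimage, mem_singleton_iff, Function.mem_support]
  exact and_congr_left fun hy => by rw [h y hy]

theorem pushforward_id (hπ : IsLocalHomeomorph (id : Y → Y)) (f : C_c(Y, ℤ)) :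
    pushforward hπ f = f := by
  ext z
  rw [pushforward_apply, preimage_id, finsum_mem_singleton]

theorem pushforward_pushforward {π : Y → Z} {π' : Z → V} (hπ : IsLocalHomeomorph π)
    (hπ' : IsLocalHomeomorph π') (f : C_c(Y, ℤ)) :
    pushforward hπ' (pushforward hπ f) = pushforward (hπ'.comp hπ) f := by
  classical
  ext v
  have hfin := finite_fiber_inter_support (hπ'.comp hπ) f v
  set T := hfin.toFinset with hT
  have hmem : ∀ y, y ∈ T ↔ π' (π y) = v ∧ f y ≠ 0 := fun y => by simp [hT]
  have h1 : pushforward (hπ'.comp hπ) f v = ∑ y ∈ T, f y := by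
    rw [pushforward_apply]
    refine finsum_mem_eq_sum_of_inter_support_eq _ ?_
    ext y
    simp [hmem]
  have h2 : ∀ z, π' z = v → pushforward hπ f z = ∑ y ∈ T with π y = z, f y := by
    rintro z rfl
    rw [pushforward_apply]
    refine finsum_mem_eq_sum_of_inter_support_eq _ ?_
    ext y
    simp only [mem_inter_iff, mem_preimage, mem_singleton_iff, Function.mem_support,
      Finset.coe_filter, hmem, mem_ofPred_eq]
    constructor
    · rintro ⟨rfl, h⟩
      exact ⟨⟨⟨rfl, h⟩, rfl⟩, h⟩
    · rintro ⟨⟨-, rfl⟩, h⟩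
      exact ⟨rfl, h⟩
  have h3 : pushforward hπ' (pushforward hπ f) v = ∑ z ∈ T.image π, pushforward hπ f z := by
    rw [pushforward_apply]
    refine finsum_mem_eq_sum_of_inter_support_eq _ ?_
    ext z
    simp only [mem_inter_iff, mem_preimage, mem_singleton_iff, Function.mem_support,
      Finset.coe_image, mem_image, Finset.mem_coe]
    refine and_congr_left fun hz => ⟨fun hzv => ?_, ?_⟩
    · rw [h2 z hzv] at hz
      obtain ⟨y, hy, -⟩ := Finset.exists_ne_zero_of_sum_ne_zero hz
      rw [Finset.mem_filter] at hy
      exact ⟨y, hy⟩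
    · rintro ⟨y, hy, rfl⟩
      exact ((hmem y).1 hy).1
  rw [h1, h3, ← Finset.sum_fiberwise_of_maps_to (t := T.image π) (g := π)
    fun y hy => Finset.mem_image_of_mem π hy]
  refine Finset.sum_congr rfl fun z hz => h2 z ?_
  obtain ⟨y, hy, rfl⟩ := Finset.mem_image.1 hz
  exact ((hmem y).1 hy).1

theorem pushforward_pushforward_eq {π : Y → Z} {π' : Z → V} {σ : Y → V}
    (hπ : IsLocalHomeomorph π) (hπ' : IsLocalHomeomorph π') (hσ : IsLocalHomeomorph σ)
    {f : C_c(Y, ℤ)} (h : ∀ y, f y ≠ 0 → π' (π y) = σ y) :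
    pushforward hπ' (pushforward hπ f) = pushforward hσ f :=
  (pushforward_pushforward hπ hπ' f).trans (pushforward_congr _ hσ h)

theorem pushforward_nonneg {π : Y → Z} (hπ : IsLocalHomeomorph π) {f : C_c(Y, ℤ)} (hf : 0 ≤ f) :
    0 ≤ pushforward hπ f := fun z => by
  rw [pushforward_apply]
  exact finsum_nonneg fun y => finsum_nonneg fun _ => hf y

theorem pushforward_mono {π : Y → Z} (hπ : IsLocalHomeomorph π) {f g : C_c(Y, ℤ)} (h : f ≤ g) :
    pushforward hπ f ≤ pushforward hπ g := by
  intro z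
  have h1 := pushforward_nonneg hπ (f := g - f) (fun y => by simpa using h y) z
  rw [map_sub] at h1
  simpa using h1

theorem restrictCc_pushforward {π : Y → Z} (hπ : IsLocalHomeomorph π) (S : Set Z)
    (hS : IsClopen S) (f : C_c(Y, ℤ)) :
    restrictCc S hS (pushforward hπ f) =
      pushforward hπ (restrictCc (π ⁻¹' S) (hS.preimage hπ.continuous) f) := by
  ext z
  rw [restrictCc_apply, pushforward_apply]
  by_cases hz : z ∈ S
  · rw [indicator_of_mem hz, pushforward_apply]
    refine finsum_mem_congr rfl fun y hy => ?_
    rw [restrictCc_apply, indicator_of_mem]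
    rw [mem_preimage, mem_singleton_iff] at hy
    rwa [mem_preimage, hy]
  · rw [indicator_of_notMem hz]
    refine (finsum_mem_eq_zero_of_forall_eq_zero fun y hy => ?_).symm
    rw [restrictCc_apply, indicator_of_notMem]
    rw [mem_preimage, mem_singleton_iff] at hy
    rwa [mem_preimage, hy]

theorem pushforward_oneCc_apply [CompactSpace Y] {π : Y → Z} (hπ : IsLocalHomeomorph π) (z : Z) :
    pushforward hπ (oneCc Y) z = (π ⁻¹' {z}).ncard := by
  have hfin := hπ.finite_fiber z
  rw [pushforward_apply, finsum_mem_congr rfl fun y _ => oneCc_apply y,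
    finsum_mem_eq_finite_toFinset_sum _ hfin, ncard_eq_toFinset_card _ hfin]
  simp

theorem pushforward_oneCc_sumElim [CompactSpace Y] [CompactSpace V] {f : Y → Z} {g : V → Z}
    (hf : IsLocalHomeomorph f) (hg : IsLocalHomeomorph g) :
    pushforward (hf.sumElim hg) (oneCc (Y ⊕ V)) =
      pushforward hf (oneCc Y) + pushforward hg (oneCc V) := by
  ext z
  rw [CompactlySupportedContinuousMap.add_apply, pushforward_oneCc_apply, pushforward_oneCc_apply,
    pushforward_oneCc_apply]
  have h1 : Sum.elim f g ⁻¹' {z} = Sum.inl '' (f ⁻¹' {z}) ∪ Sum.inr '' (g ⁻¹' {z}) := by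
    ext (x | x) <;> simp
  rw [h1, ncard_union_eq ?_ ((hf.finite_fiber z).image _) ((hg.finite_fiber z).image _),
    ncard_image_of_injective _ Sum.inl_injective, ncard_image_of_injective _ Sum.inr_injective]
  · push_cast
    rfl
  · rw [Set.disjoint_left]
    rintro _ ⟨x, -, rfl⟩ ⟨y, -, h⟩
    exact Sum.inr_ne_inl h

theorem pushforward_oneCc_prod [CompactSpace Y] {n : ℕ} {f : Y × Fin n → Z}
    (hf : ∀ i, IsLocalHomeomorph fun y => f (y, i)) :
    pushforward (.of_prod_discrete hf) (oneCc (Y × Fin n)) =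
      ∑ i, pushforward (hf i) (oneCc Y) := by
  ext z
  rw [CompactlySupportedContinuousMap.sum_apply, pushforward_oneCc_apply]
  simp only [pushforward_oneCc_apply]
  have hfin := (IsLocalHomeomorph.of_prod_discrete hf).finite_fiber z
  have hinj : ∀ i : Fin n, Function.Injective fun y : Y => (y, i) :=
    fun i x y h => (Prod.ext_iff.1 h).1
  rw [ncard_eq_toFinset_card _ hfin, Finset.card_eq_sum_card_fiberwise (f := Prod.snd)
    (t := Finset.univ) fun _ _ => Finset.mem_coe.2 (Finset.mem_univ _), Nat.cast_sum]
  refine Finset.sum_congr rfl fun i _ => ?_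
  rw [← ncard_image_of_injective _ (hinj i), ← ncard_coe_finset]
  congr 2
  ext ⟨y, j⟩
  simp only [Finset.coe_filter, Finite.mem_toFinset, mem_ofPred_eq, mem_preimage,
    mem_singleton_iff, mem_image, Prod.mk.injEq]
  constructor
  · rintro ⟨h, rfl⟩
    exact ⟨y, h, rfl, rfl⟩
  · rintro ⟨y, h, rfl, rfl⟩
    exact ⟨h, rfl⟩

theorem pushforward_layers {f : C_c(Y, ℤ)} (hf : 0 ≤ f) :
    pushforward (isLocalHomeomorph_layers f) (oneCc (Layers f)) = f := by
  ext y
  rw [pushforward_oneCc_apply]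
  have h1 : Subtype.val '' ((fun p : Layers f => p.1.1) ⁻¹' {y}) =
      (fun n : ℕ => (y, n)) '' (Iio (f y).toNat) := by
    ext ⟨a, n⟩
    simp only [mem_image, mem_preimage, mem_singleton_iff, Subtype.exists, mem_Iio, Prod.mk.injEq]
    constructor
    · rintro ⟨⟨a', n'⟩, h, rfl, h'⟩
      simp only [Prod.mk.injEq] at h'
      obtain ⟨rfl, rfl⟩ := h'
      exact ⟨n', by omega, rfl, rfl⟩
    · rintro ⟨n', h, rfl, rfl⟩
      exact ⟨(y, n'), by simpa using by omega, rfl, rfl⟩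
  rw [← ncard_image_of_injective _ Subtype.val_injective, h1,
    ncard_image_of_injective _ (fun a b h => (Prod.ext_iff.1 h).2),
    ncard_eq_toFinset_card' (Iio _)]
  have := hf y
  simpa using this

end Pushforward

namespace EtaleGroupoid

/-! ### Principal groupoids and orbit sections -/

section OrbitSection

variable {G X : Type*} [TopologicalSpace G] [TopologicalSpace X] {𝒢 : EtaleGroupoid G X}

theorem mul_eq_left {a b : G} (e : 𝒢.s a = 𝒢.r b) (hb : b ∈ range 𝒢.unit) : 𝒢.mul a b e = a := by
  obtain ⟨x, rfl⟩ := hb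
  rw [𝒢.r_unit] at e
  subst e
  exact 𝒢.mul_unit a

theorem mul_eq_right {a b : G} (e : 𝒢.s a = 𝒢.r b) (ha : a ∈ range 𝒢.unit) :
    𝒢.mul a b e = b := by
  obtain ⟨x, rfl⟩ := ha
  rw [𝒢.s_unit] at e
  subst e
  exact 𝒢.unit_mul b

/-- In a principal groupoid an arrow is determined by its source and its range. -/
theorem IsPrincipal.ext (h : 𝒢.IsPrincipal) {g g' : G} (hs : 𝒢.s g = 𝒢.s g')
    (hr : 𝒢.r g = 𝒢.r g') : g = g' := by
  have e : 𝒢.s (𝒢.inv g) = 𝒢.r g' := (𝒢.s_inv g).trans hr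
  have h1 : 𝒢.mul (𝒢.inv g) g' e ∈ range 𝒢.unit := by
    rw [← h]
    change 𝒢.r _ = 𝒢.s _
    rw [𝒢.r_mul, 𝒢.s_mul, 𝒢.r_inv, hs]
  have h2 := 𝒢.mul_assoc g (𝒢.inv g) g' (𝒢.r_inv g).symm e
  rw [mul_eq_left _ h1, mul_eq_right _ ⟨_, (𝒢.mul_inv g).symm⟩] at h2
  exact h2.symm

theorem IsPrincipal.mem_range_unit_iff (h : 𝒢.IsPrincipal) {g : G} :
    g ∈ range 𝒢.unit ↔ 𝒢.s g = 𝒢.r g := by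
  rw [← h]
  exact eq_comm

theorem continuous_mul_of {Z : Type*} [TopologicalSpace Z] {a b : Z → G} (ha : Continuous a)
    (hb : Continuous b) (e : ∀ z, 𝒢.s (a z) = 𝒢.r (b z)) :
    Continuous fun z => 𝒢.mul (a z) (b z) (e z) :=
  𝒢.continuous_mul.comp ((ha.prodMk hb).subtype_mk e)

variable (𝒢) in
theorem isLocalHomeomorph_inv : IsLocalHomeomorph 𝒢.inv := by
  refine IsLocalHomeomorph.of_comp (g := 𝒢.s) ?_ 𝒢.isLocalHomeomorph_s 𝒢.continuous_inv
  rw [show 𝒢.s ∘ 𝒢.inv = 𝒢.r from funext 𝒢.s_inv]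
  exact 𝒢.isLocalHomeomorph_r

theorem isLocalHomeomorph_of_s {Z : Type*} [TopologicalSpace Z] {a : Z → G} {b : Z → X}
    (ha : Continuous a) (hb : IsLocalHomeomorph b) (h : ∀ z, 𝒢.s (a z) = b z) :
    IsLocalHomeomorph a := by
  refine IsLocalHomeomorph.of_comp (g := 𝒢.s) ?_ 𝒢.isLocalHomeomorph_s ha
  rwa [show 𝒢.s ∘ a = b from funext h]

theorem isLocalHomeomorph_of_r {Z : Type*} [TopologicalSpace Z] {a : Z → G} {b : Z → X}
    (ha : Continuous a) (hb : IsLocalHomeomorph b) (h : ∀ z, 𝒢.r (a z) = b z) :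
    IsLocalHomeomorph a := by
  refine IsLocalHomeomorph.of_comp (g := 𝒢.r) ?_ 𝒢.isLocalHomeomorph_r ha
  rwa [show 𝒢.r ∘ a = b from funext h]

variable (𝒢) in
theorem isLocalHomeomorph_unit : IsLocalHomeomorph 𝒢.unit :=
  isLocalHomeomorph_of_s 𝒢.continuous_unit isLocalHomeomorph_id 𝒢.s_unit

theorem pushforward_comp_s_eq_comp_r {V : Type*} [TopologicalSpace V] [T2Space G] [T2Space X]
    [T2Space V] {a : X → V} (ha : IsLocalHomeomorph a) {f : C_c(G, ℤ)} (hf : 𝒢.δ₁ f = 0) :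
    pushforward (ha.comp 𝒢.isLocalHomeomorph_s) f =
      pushforward (ha.comp 𝒢.isLocalHomeomorph_r) f := by
  have h1 : pushforward 𝒢.isLocalHomeomorph_s f = pushforward 𝒢.isLocalHomeomorph_r f :=
    sub_eq_zero.1 hf
  rw [← pushforward_pushforward 𝒢.isLocalHomeomorph_s ha,
    ← pushforward_pushforward 𝒢.isLocalHomeomorph_r ha, h1]

variable (𝒢) in
/-- A continuous choice, for every unit `x`, of an arrow to `x` from a representative
`s (c x)` of a class of a partition of the unit space into subsets of orbits. An elementary
subgroupoid `K` gives such a section for the partition into `K`-orbits; conversely, in a principal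
groupoid `K` is recovered as the set of arrows joining units with the same representative. -/
structure OrbitSection where
  /-- the chosen arrow with range `x` -/
  toFun : X → G
  continuous_toFun : Continuous toFun
  r_apply : ∀ x, 𝒢.r (toFun x) = x
  s_idem : ∀ x, 𝒢.s (toFun (𝒢.s (toFun x))) = 𝒢.s (toFun x)

namespace OrbitSection

instance : CoeFun 𝒢.OrbitSection fun _ => X → G := ⟨toFun⟩

variable (c : 𝒢.OrbitSection)

/-- The representative of the class of `x`. -/
def proj (x : X) : X := 𝒢.s (c x)

theorem s_apply (x : X) : 𝒢.s (c x) = c.proj x := rfl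

theorem proj_proj (x : X) : c.proj (c.proj x) = c.proj x := c.s_idem x

theorem isLocalHomeomorph_toFun : IsLocalHomeomorph c :=
  isLocalHomeomorph_of_r c.continuous_toFun isLocalHomeomorph_id c.r_apply

theorem isLocalHomeomorph_proj : IsLocalHomeomorph c.proj :=
  𝒢.isLocalHomeomorph_s.comp c.isLocalHomeomorph_toFun

/-- Transport of an arrow `g` to the representatives of its end points:
`c(r(g))⁻¹ g c(s(g))`. -/
def retract (g : G) : G :=
  𝒢.mul (𝒢.inv (c (𝒢.r g))) (𝒢.mul g (c (𝒢.s g)) (c.r_apply _).symm)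
    ((𝒢.s_inv _).trans ((c.r_apply _).trans (𝒢.r_mul _ _ _).symm))

theorem s_retract (g : G) : 𝒢.s (c.retract g) = c.proj (𝒢.s g) := by
  rw [retract, 𝒢.s_mul, 𝒢.s_mul, s_apply]

theorem r_retract (g : G) : 𝒢.r (c.retract g) = c.proj (𝒢.r g) := by
  rw [retract, 𝒢.r_mul, 𝒢.r_inv, s_apply]

theorem continuous_retract : Continuous c.retract :=
  continuous_mul_of
    (𝒢.continuous_inv.comp (c.continuous_toFun.comp 𝒢.isLocalHomeomorph_r.continuous))
    (continuous_mul_of continuous_id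
      (c.continuous_toFun.comp 𝒢.isLocalHomeomorph_s.continuous) _) _

theorem isLocalHomeomorph_retract : IsLocalHomeomorph c.retract :=
  isLocalHomeomorph_of_s c.continuous_retract
    (c.isLocalHomeomorph_proj.comp 𝒢.isLocalHomeomorph_s) c.s_retract

theorem retract_eq_retract (h : 𝒢.IsPrincipal) {g g' : G}
    (hs : c.proj (𝒢.s g) = c.proj (𝒢.s g')) (hr : c.proj (𝒢.r g) = c.proj (𝒢.r g')) :
    c.retract g = c.retract g' :=
  h.ext (by rw [s_retract, s_retract, hs]) (by rw [r_retract, r_retract, hr])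

/-- The set of arrows joining different classes. -/
def crossing : Set G := {g | c.proj (𝒢.s g) ≠ c.proj (𝒢.r g)}

theorem crossing_eq (h : 𝒢.IsPrincipal) : c.crossing = c.retract ⁻¹' (range 𝒢.unit)ᶜ := by
  ext g
  rw [mem_preimage, mem_compl_iff, h.mem_range_unit_iff, s_retract, r_retract]
  rfl

theorem isClopen_crossing [T2Space X] (h : 𝒢.IsPrincipal) : IsClopen c.crossing := by
  constructor
  · rw [crossing_eq c h]
    exact (𝒢.isOpen_range_unit.isClosed_compl).preimage c.continuous_retract
  · exact isOpen_ne_fun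
      (c.isLocalHomeomorph_proj.continuous.comp 𝒢.isLocalHomeomorph_s.continuous)
      (c.isLocalHomeomorph_proj.continuous.comp 𝒢.isLocalHomeomorph_r.continuous)

variable [T2Space X]

/-- The part of a function on `G` which is supported on the arrows joining different classes. -/
def cut (h : 𝒢.IsPrincipal) : C_c(G, ℤ) →+ C_c(G, ℤ) :=
  restrictCc c.crossing (c.isClopen_crossing h)

theorem cut_apply (h : 𝒢.IsPrincipal) (f : C_c(G, ℤ)) (g : G) :
    c.cut h f g = c.crossing.indicator f g := rfl

theorem cut_nonneg (h : 𝒢.IsPrincipal) {f : C_c(G, ℤ)} (hf : 0 ≤ f) : 0 ≤ c.cut h f :=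
  restrictCc_nonneg _ _ hf

theorem cut_le (h : 𝒢.IsPrincipal) {f : C_c(G, ℤ)} (hf : 0 ≤ f) : c.cut h f ≤ f :=
  restrictCc_le _ _ hf

theorem cut_apply_ne_zero (h : 𝒢.IsPrincipal) {f : C_c(G, ℤ)} {g : G} (hg : c.cut h f g ≠ 0) :
    c.proj (𝒢.s g) ≠ c.proj (𝒢.r g) :=
  (indicator_apply_ne_zero.1 hg).1

theorem sub_cut_apply_ne_zero (h : 𝒢.IsPrincipal) {f : C_c(G, ℤ)} {g : G}
    (hg : (f - c.cut h f) g ≠ 0) : c.proj (𝒢.s g) = c.proj (𝒢.r g) := by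
  by_contra hne
  refine hg ?_
  rw [CompactlySupportedContinuousMap.sub_apply, cut_apply, indicator_of_mem hne, sub_self]

theorem cut_cut (h : 𝒢.IsPrincipal) (f : C_c(G, ℤ)) : c.cut h (c.cut h f) = c.cut h f :=
  restrictCc_restrictCc _ _ _

theorem cut_eq_zero (h : 𝒢.IsPrincipal) {f : C_c(G, ℤ)}
    (hf : ∀ g, f g ≠ 0 → c.proj (𝒢.s g) = c.proj (𝒢.r g)) : c.cut h f = 0 := by
  ext g
  by_contra hg
  exact c.cut_apply_ne_zero h hg (hf g (indicator_apply_ne_zero.1 hg).2)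

variable [T2Space G]

/-- The crossing part of a function, transported to the arrows between representatives.
This records how many arrows lead from one class to another. -/
def reduce (h : 𝒢.IsPrincipal) : C_c(G, ℤ) →+ C_c(G, ℤ) :=
  (pushforward c.isLocalHomeomorph_retract).comp (c.cut h)

theorem reduce_apply (h : 𝒢.IsPrincipal) (f : C_c(G, ℤ)) :
    c.reduce h f = pushforward c.isLocalHomeomorph_retract (c.cut h f) := rfl

theorem reduce_cut (h : 𝒢.IsPrincipal) (f : C_c(G, ℤ)) :
    c.reduce h (c.cut h f) = c.reduce h f := by
  rw [reduce_apply, reduce_apply, cut_cut]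

theorem reduce_eq_restrictCc (h : 𝒢.IsPrincipal) (f : C_c(G, ℤ))
    (hu : IsClopen (range 𝒢.unit)ᶜ) :
    c.reduce h f = restrictCc _ hu (pushforward c.isLocalHomeomorph_retract f) := by
  rw [restrictCc_pushforward, reduce_apply]
  congr 1
  ext g
  rw [cut_apply, restrictCc_apply, c.crossing_eq h]

/-- For a cycle, as many crossing arrows start in each class as end in it. -/
theorem pushforward_cut_of_mem_ker (h : 𝒢.IsPrincipal) {f : C_c(G, ℤ)} (hf : 𝒢.δ₁ f = 0) :
    pushforward (c.isLocalHomeomorph_proj.comp 𝒢.isLocalHomeomorph_s) (c.cut h f) =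
      pushforward (c.isLocalHomeomorph_proj.comp 𝒢.isLocalHomeomorph_r) (c.cut h f) := by
  have h1 : pushforward (c.isLocalHomeomorph_proj.comp 𝒢.isLocalHomeomorph_s) (f - c.cut h f) =
      pushforward (c.isLocalHomeomorph_proj.comp 𝒢.isLocalHomeomorph_r) (f - c.cut h f) :=
    pushforward_congr _ _ fun g hg => c.sub_cut_apply_ne_zero h hg
  have h2 : pushforward (c.isLocalHomeomorph_proj.comp 𝒢.isLocalHomeomorph_s) f =
      pushforward (c.isLocalHomeomorph_proj.comp 𝒢.isLocalHomeomorph_r) f :=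
    pushforward_comp_s_eq_comp_r c.isLocalHomeomorph_proj hf
  rw [map_sub, map_sub, h2] at h1
  exact sub_right_injective h1

end OrbitSection

variable [T2Space G] [T2Space X]

/-- Functions supported on the units are boundaries, by way of the pairs `(x, x)`. -/
theorem mem_range_δ₂_of_support_subset_range_unit {f : C_c(G, ℤ)}
    (hf : ∀ g, f g ≠ 0 → g ∈ range 𝒢.unit) : f ∈ 𝒢.δ₂.range := by
  let υ : X → 𝒢.Pairs := fun x => ⟨(𝒢.unit x, 𝒢.unit x), by rw [𝒢.s_unit, 𝒢.r_unit]⟩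
  have hυ : IsLocalHomeomorph υ := by
    refine IsLocalHomeomorph.of_comp (g := 𝒢.d₀) 𝒢.isLocalHomeomorph_unit 𝒢.isLocalHomeomorph_d₀ ?_
    exact (𝒢.continuous_unit.prodMk 𝒢.continuous_unit).subtype_mk _
  set w := pushforward 𝒢.isLocalHomeomorph_r f with hw
  have h0 : pushforward 𝒢.isLocalHomeomorph_unit w = f := by
    rw [hw, pushforward_pushforward_eq _ _ isLocalHomeomorph_id, pushforward_id]
    intro g hg
    obtain ⟨x, rfl⟩ := hf g hg
    rw [𝒢.r_unit, id]
  refine ⟨pushforward hυ w, ?_⟩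
  rw [δ₂, AddMonoidHom.add_apply, AddMonoidHom.sub_apply,
    pushforward_pushforward_eq hυ 𝒢.isLocalHomeomorph_d₀ 𝒢.isLocalHomeomorph_unit fun _ _ => rfl,
    pushforward_pushforward_eq hυ 𝒢.isLocalHomeomorph_d₁ 𝒢.isLocalHomeomorph_unit
      fun x _ => mul_eq_left _ ⟨x, rfl⟩,
    pushforward_pushforward_eq hυ 𝒢.isLocalHomeomorph_d₂ 𝒢.isLocalHomeomorph_unit fun _ _ => rfl,
    h0, sub_self, zero_add]

/-- A `1`-cycle whose crossing part cancels after transport to the representatives is a boundary: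
conjugation by the section gives a chain homotopy from the identity to the retraction. -/
theorem OrbitSection.mem_range_δ₂ (c : 𝒢.OrbitSection) (h : 𝒢.IsPrincipal) {f : C_c(G, ℤ)}
    (hf : 𝒢.δ₁ f = 0) (hc : c.reduce h f = 0) : f ∈ 𝒢.δ₂.range := by
  let ψ₁ : G → 𝒢.Pairs := fun g => ⟨(g, c (𝒢.s g)), (c.r_apply _).symm⟩
  let ψ₂ : G → 𝒢.Pairs := fun g => ⟨(c (𝒢.r g), c.retract g), (c.r_retract g).symm⟩
  have hcs := c.isLocalHomeomorph_toFun.comp 𝒢.isLocalHomeomorph_s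
  have hcr := c.isLocalHomeomorph_toFun.comp 𝒢.isLocalHomeomorph_r
  have hψ₁ : IsLocalHomeomorph ψ₁ :=
    IsLocalHomeomorph.of_comp (g := 𝒢.d₂) isLocalHomeomorph_id 𝒢.isLocalHomeomorph_d₂
      ((continuous_id.prodMk hcs.continuous).subtype_mk _)
  have hψ₂ : IsLocalHomeomorph ψ₂ :=
    IsLocalHomeomorph.of_comp (g := 𝒢.d₀) c.isLocalHomeomorph_retract 𝒢.isLocalHomeomorph_d₀
      ((hcr.continuous.prodMk c.continuous_retract).subtype_mk _)
  have h1 : 𝒢.δ₂ (pushforward hψ₁ f - pushforward hψ₂ f) =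
      f - pushforward c.isLocalHomeomorph_retract f := by
    have e : ∀ g, 𝒢.d₁ (ψ₁ g) = 𝒢.d₁ (ψ₂ g) := fun g => by
      refine h.ext ?_ ?_
      · rw [d₁, d₁, 𝒢.s_mul, 𝒢.s_mul, c.s_retract, c.s_apply]
      · rw [d₁, d₁, 𝒢.r_mul, 𝒢.r_mul, c.r_apply]
    have hcyc : pushforward hcs f = pushforward hcr f :=
      pushforward_comp_s_eq_comp_r c.isLocalHomeomorph_toFun hf
    rw [map_sub, δ₂]
    simp only [AddMonoidHom.add_apply, AddMonoidHom.sub_apply]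
    rw [pushforward_pushforward_eq hψ₁ 𝒢.isLocalHomeomorph_d₀ hcs fun _ _ => rfl,
      pushforward_pushforward_eq hψ₁ 𝒢.isLocalHomeomorph_d₂ isLocalHomeomorph_id fun _ _ => rfl,
      pushforward_pushforward_eq hψ₂ 𝒢.isLocalHomeomorph_d₀ c.isLocalHomeomorph_retract
        fun _ _ => rfl,
      pushforward_pushforward_eq hψ₂ 𝒢.isLocalHomeomorph_d₂ hcr fun _ _ => rfl,
      pushforward_pushforward_eq hψ₁ 𝒢.isLocalHomeomorph_d₁ (𝒢.isLocalHomeomorph_d₁.comp hψ₂)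
        fun g _ => e g, pushforward_pushforward, pushforward_id, hcyc]
    abel
  have h2 : pushforward c.isLocalHomeomorph_retract f ∈ 𝒢.δ₂.range := by
    have h3 : pushforward c.isLocalHomeomorph_retract f =
        pushforward c.isLocalHomeomorph_retract (f - c.cut h f) := by
      rw [map_sub, ← reduce_apply, hc, sub_zero]
    refine mem_range_δ₂_of_support_subset_range_unit fun g hg => ?_
    rw [h3, pushforward_apply] at hg
    obtain ⟨g', hg', hne⟩ := exists_ne_zero_of_finsum_mem_ne_zero hg
    rw [mem_preimage, mem_singleton_iff] at hg'
    rw [← hg', h.mem_range_unit_iff, s_retract, r_retract]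
    exact c.sub_cut_apply_ne_zero h hne
  rw [← sub_add_cancel f (pushforward c.isLocalHomeomorph_retract f)]
  exact add_mem ⟨_, h1⟩ h2

end OrbitSection

/-! ### Orbit sections from almost finiteness -/

section AlmostFinite

variable {G X : Type*} [TopologicalSpace G] [TopologicalSpace X] {𝒢 : EtaleGroupoid G X}
  [T2Space X] [CompactSpace X]

/-- The orbit partition of an elementary subgroupoid `K` has a section with values in `K`:
label the units so that distinct points of a `K`-orbit have distinct labels, and take the point of
least label in each orbit as representative. -/
theorem IsElementarySubgroupoid.exists_orbitSection [TotallyDisconnectedSpace X]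
    (h : 𝒢.IsPrincipal) {K : Set G}
    (hK : 𝒢.IsElementarySubgroupoid K) :
    ∃ c : 𝒢.OrbitSection, (∀ x, c x ∈ K) ∧ ∀ k ∈ K, c.proj (𝒢.s k) = c.proj (𝒢.r k) := by
  have hsc := 𝒢.isLocalHomeomorph_s.continuous
  have hrc := 𝒢.isLocalHomeomorph_r.continuous
  have hloc : ∀ x : X, ∃ W, IsOpen W ∧ x ∈ W ∧ ∀ y ∈ W, ∀ z ∈ W,
      (∃ k ∈ K, 𝒢.s k = y ∧ 𝒢.r k = z) → y = z := by
    intro x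
    have h1 : IsClosed ((fun k => (𝒢.s k, 𝒢.r k)) '' (K \ range 𝒢.unit)) :=
      ((hK.isCompact.diff 𝒢.isOpen_range_unit).image (hsc.prodMk hrc)).isClosed
    have h2 : (x, x) ∈ ((fun k => (𝒢.s k, 𝒢.r k)) '' (K \ range 𝒢.unit))ᶜ := by
      rintro ⟨k, ⟨-, hk⟩, hkx⟩
      rw [Prod.mk.injEq] at hkx
      exact hk (h.mem_range_unit_iff.2 (hkx.1.trans hkx.2.symm))
    obtain ⟨U, V, hU, hV, hxU, hxV, hUV⟩ := isOpen_prod_iff.1 h1.isOpen_compl x x h2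
    refine ⟨U ∩ V, hU.inter hV, ⟨hxU, hxV⟩, ?_⟩
    rintro y hy z hz ⟨k, hk, rfl, rfl⟩
    by_contra hne
    exact hUV (mk_mem_prod hy.1 hz.2)
      ⟨k, ⟨hk, fun hku => hne (h.mem_range_unit_iff.1 hku)⟩, rfl⟩
  obtain ⟨l, hlc, hl⟩ := exists_continuous_label _ hloc
  let Y : Set X := {x | ∀ k ∈ K, 𝒢.s k = x → l x ≤ l (𝒢.r k)}
  have hY : IsClosed Y := by
    have h1 : Yᶜ = 𝒢.s '' (K ∩ {k | l (𝒢.r k) < l (𝒢.s k)}) := by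
      ext x
      simp only [Y, mem_compl_iff, mem_ofPred_eq, not_forall, not_le, mem_image, mem_inter_iff]
      constructor
      · rintro ⟨k, hk, rfl, hlt⟩
        exact ⟨k, ⟨hk, hlt⟩, rfl⟩
      · rintro ⟨k, ⟨hk, hlt⟩, rfl⟩
        exact ⟨k, hk, rfl, hlt⟩
    have h2 : IsOpen {k | l (𝒢.r k) < l (𝒢.s k)} :=
      (isOpen_discrete {p : ℕ × ℕ | p.1 < p.2}).preimage
        ((hlc.comp hrc).prodMk (hlc.comp hsc))
    rw [← isOpen_compl_iff, h1]
    exact 𝒢.isLocalHomeomorph_s.isOpenMap _ (hK.isOpen.inter h2)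
  let V : Set G := K ∩ 𝒢.s ⁻¹' Y
  have hV : CompactSpace V :=
    isCompact_iff_compactSpace.1 (hK.isCompact.inter_right (hY.preimage hsc))
  have huniq : ∀ k ∈ V, ∀ k' ∈ V, 𝒢.r k = 𝒢.r k' → k = k' := by
    intro k hk k' hk' hr
    have e : 𝒢.s (𝒢.inv k) = 𝒢.r k' := (𝒢.s_inv k).trans hr
    have e' : 𝒢.s (𝒢.inv k') = 𝒢.r k := (𝒢.s_inv k').trans hr.symm
    have hm := hK.mul_mem _ (hK.inv_mem _ hk.1) _ hk'.1 e
    have hm' := hK.mul_mem _ (hK.inv_mem _ hk'.1) _ hk.1 e'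
    have h1 := hk'.2 _ hm (𝒢.s_mul _ _ _)
    have h2 := hk.2 _ hm' (𝒢.s_mul _ _ _)
    rw [𝒢.r_mul, 𝒢.r_inv] at h1 h2
    refine h.ext (hl _ _ ⟨_, hm', 𝒢.s_mul _ _ _, ?_⟩ (h2.antisymm h1)) hr
    rw [𝒢.r_mul, 𝒢.r_inv]
  have hbij : Function.Bijective fun k : V => 𝒢.r k := by
    refine ⟨fun k k' hr => Subtype.ext (huniq k k.2 k' k'.2 hr), fun x => ?_⟩
    have hne : ((fun k => l (𝒢.s k)) '' {k ∈ K | 𝒢.r k = x}).Nonempty :=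
      ⟨_, 𝒢.unit x, ⟨hK.unit_mem x, 𝒢.r_unit x⟩, rfl⟩
    obtain ⟨k, ⟨hk, hkx⟩, hkl⟩ := Nat.sInf_mem hne
    refine ⟨⟨k, hk, fun k' hk' hs => ?_⟩, hkx⟩
    have e : 𝒢.s k = 𝒢.r (𝒢.inv k') := by rw [𝒢.r_inv, hs]
    refine hkl.trans_le (Nat.sInf_le ⟨𝒢.mul k (𝒢.inv k') e,
      ⟨hK.mul_mem _ hk _ (hK.inv_mem _ hk') e, (𝒢.r_mul _ _ _).trans hkx⟩, ?_⟩)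
    simp only [𝒢.s_mul, 𝒢.s_inv]
  have hcont : Continuous fun k : V => 𝒢.r k := hrc.comp continuous_subtype_val
  let φ : V ≃ₜ X := Continuous.homeoOfEquivCompactToT2 (f := Equiv.ofBijective _ hbij) hcont
  have hφ : ∀ x, 𝒢.r (φ.symm x : G) = x := φ.apply_symm_apply
  have hinv : ∀ k ∈ K, 𝒢.s (φ.symm (𝒢.s k) : G) = 𝒢.s (φ.symm (𝒢.r k) : G) := by
    intro k hk
    have e : 𝒢.s k = 𝒢.r (φ.symm (𝒢.s k) : G) := (hφ _).symm
    have h1 : 𝒢.s (𝒢.mul k _ e) = 𝒢.s (φ.symm (𝒢.s k) : G) := 𝒢.s_mul _ _ _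
    have h2 : 𝒢.mul k _ e ∈ V := by
      refine ⟨hK.mul_mem _ hk _ (φ.symm (𝒢.s k)).2.1 e, ?_⟩
      rw [mem_preimage, h1]
      exact (φ.symm (𝒢.s k)).2.2
    rw [← h1]
    congr 1
    exact huniq _ h2 _ (φ.symm (𝒢.r k)).2 ((𝒢.r_mul _ _ _).trans (hφ _).symm)
  refine ⟨⟨fun x => φ.symm x, continuous_subtype_val.comp φ.symm.continuous, hφ, fun x => ?_⟩,
    fun x => (φ.symm x).2.1, hinv⟩
  rw [hinv _ (φ.symm x).2.1, hφ]

/-- In an almost finite principal groupoid, every nonnegative compactly supported function `u` has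
few crossing arrows with respect to a suitable orbit section: over each representative, the total
mass of crossing arrows issuing from its class is at most the size of the class. -/
theorem IsAlmostFinite.exists_orbitSection [T2Space G] [TotallyDisconnectedSpace X]
    (haf : 𝒢.IsAlmostFinite) (h : 𝒢.IsPrincipal)
    {u : C_c(G, ℤ)} (hu : 0 ≤ u) :
    ∃ c : 𝒢.OrbitSection,
      pushforward (c.isLocalHomeomorph_proj.comp 𝒢.isLocalHomeomorph_s) (c.cut h u) ≤
        pushforward c.isLocalHomeomorph_proj (oneCc X) := by
  classical
  -- `M` bounds the mass of `u` on each fibre of `r`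
  obtain ⟨M, hM0, hM⟩ : ∃ M : ℕ, 0 < M ∧ ∀ z, pushforward 𝒢.isLocalHomeomorph_r u z ≤ M := by
    obtain ⟨M, hM⟩ := (isCompact_range (pushforward 𝒢.isLocalHomeomorph_r u).continuous).bddAbove
    refine ⟨M.toNat + 1, by omega, fun z => (hM (mem_range_self z)).trans ?_⟩
    push_cast
    omega
  set C : Set G := Function.support u with hC
  have hCc : IsCompact C := by
    have h1 : IsClosed C := (isClosed_discrete ({0}ᶜ : Set ℤ)).preimage u.continuous
    exact u.hasCompactSupport.of_isClosed_subset h1 (subset_tsupport _)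
  obtain ⟨K, hK, hKC⟩ := haf C hCc (1 / M) (by positivity)
  obtain ⟨c, hcK, hc⟩ := hK.exists_orbitSection h
  refine ⟨c, fun y => ?_⟩
  have hps := c.isLocalHomeomorph_proj.comp 𝒢.isLocalHomeomorph_s
  have hfin := finite_fiber_inter_support hps (c.cut h u) y
  set T := hfin.toFinset with hT
  have hmem : ∀ g, g ∈ T ↔ c.proj (𝒢.s g) = y ∧ c.cut h u g ≠ 0 := fun g => by simp [hT]
  have hsum : pushforward hps (c.cut h u) y = ∑ g ∈ T, c.cut h u g := by
    rw [pushforward_apply]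
    refine finsum_mem_eq_sum_of_inter_support_eq _ ?_
    ext g
    simp [hmem]
  rw [hsum, pushforward_oneCc_apply]
  rcases T.eq_empty_or_nonempty with hTe | ⟨g₀, hg₀⟩
  · rw [hTe, Finset.sum_empty]
    positivity
  have hy : c.proj y = y := by
    rw [← ((hmem g₀).1 hg₀).1, c.proj_proj]
  have hcut : ∀ g ∈ T, g ∈ C ∧ c.proj (𝒢.s g) ≠ c.proj (𝒢.r g) := fun g hg =>
    ⟨(indicator_apply_ne_zero.1 ((hmem g).1 hg).2).2, c.cut_apply_ne_zero h ((hmem g).1 hg).2⟩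
  have horb : 𝒢.orbit K y = c.proj ⁻¹' {y} := by
    ext x
    constructor
    · rintro ⟨k, ⟨hk, hky⟩, rfl⟩
      rw [mem_preimage, mem_singleton_iff, ← hc k hk, hky, hy]
    · rintro (hx : c.proj x = y)
      exact ⟨c x, ⟨hcK x, hx⟩, c.r_apply x⟩
  set D := 𝒢.mulSet C (𝒢.sourceFiber K y) \ 𝒢.sourceFiber K y with hD
  have hDfin : D.Finite := by
    have hPc := 𝒢.isCompact_pairs hCc hK.isCompact
    have hmc : IsCompact (𝒢.mulSet C K) := by
      rw [mulSet_eq_image]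
      exact hPc.image 𝒢.isLocalHomeomorph_d₁.continuous
    have h1 : IsCompact (𝒢.mulSet C K ∩ 𝒢.s ⁻¹' {y}) :=
      hmc.inter_right (isClosed_singleton.preimage 𝒢.isLocalHomeomorph_s.continuous)
    refine (h1.finite ((𝒢.isLocalHomeomorph_s.isDiscrete_fiber y).mono inter_subset_right)).subset ?_
    rintro _ ⟨⟨a, ha, b, hb, e, rfl⟩, -⟩
    exact ⟨⟨a, ha, b, hb.1, e, rfl⟩, (𝒢.s_mul _ _ _).trans hb.2⟩
  have hTD : ((T.image 𝒢.r : Finset X) : Set X) ⊆ 𝒢.r '' D := by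
    intro z hz
    obtain ⟨g, hg, rfl⟩ := Finset.mem_image.1 (Finset.mem_coe.1 hz)
    have hgy := ((hmem g).1 hg).1
    have e : 𝒢.s g = 𝒢.r (c (𝒢.s g)) := (c.r_apply _).symm
    refine ⟨𝒢.mul g (c (𝒢.s g)) e, ⟨⟨g, (hcut g hg).1, _, ⟨hcK _, hgy⟩, e, rfl⟩, ?_⟩,
      𝒢.r_mul _ _ _⟩
    rintro ⟨hk, -⟩
    have h1 := hc _ hk
    rw [𝒢.s_mul, 𝒢.r_mul, c.s_apply, c.proj_proj] at h1
    exact (hcut g hg).2 h1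
  have hcard : (T.image 𝒢.r).card ≤ D.ncard := by
    rw [← ncard_coe_finset]
    exact (ncard_le_ncard hTD (hDfin.image _)).trans (ncard_image_le hDfin)
  have hpos : 0 < (c.proj ⁻¹' {y}).ncard :=
    (ncard_pos (c.isLocalHomeomorph_proj.finite_fiber y)).2 ⟨y, hy⟩
  have hMD : M * D.ncard ≤ (c.proj ⁻¹' {y}).ncard := by
    have h1 := hKC y
    rw [horb, ← hD, div_lt_div_iff₀ (by exact_mod_cast hpos) (by exact_mod_cast hM0), one_mul] at h1
    rw [mul_comm]
    exact_mod_cast h1.le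
  have hle : ∑ g ∈ T, c.cut h u g ≤ (T.image 𝒢.r).card * M := by
    rw [← Finset.sum_fiberwise_of_maps_to (t := T.image 𝒢.r) (g := 𝒢.r)
      fun g hg => Finset.mem_image_of_mem _ hg, ← nsmul_eq_mul]
    refine Finset.sum_le_card_nsmul _ _ _ fun z _ => le_trans ?_
      ((pushforward_mono 𝒢.isLocalHomeomorph_r (c.cut_le h hu) z).trans (hM z))
    have hfinz := finite_fiber_inter_support 𝒢.isLocalHomeomorph_r (c.cut h u) z
    have h1 : pushforward 𝒢.isLocalHomeomorph_r (c.cut h u) z =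
        ∑ g ∈ hfinz.toFinset, c.cut h u g := by
      rw [pushforward_apply]
      refine finsum_mem_eq_sum_of_inter_support_eq _ ?_
      ext g
      simp
    refine le_trans ?_ h1.ge
    refine Finset.sum_le_sum_of_subset_of_nonneg (fun g hg => ?_)
      fun g _ _ => c.cut_nonneg h hu g
    rw [Finset.mem_filter, hmem] at hg
    rw [Finite.mem_toFinset]
    exact ⟨hg.2, hg.1.2⟩
  calc ∑ g ∈ T, c.cut h u g ≤ (T.image 𝒢.r).card * M := hle
    _ ≤ D.ncard * M := by gcongr
    _ ≤ _ := by rw [mul_comm]; exact_mod_cast hMD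

end AlmostFinite

end EtaleGroupoid

/-! ### Extending homeomorphisms from a clopen subspace -/

section Extend

variable {W X Z : Type*} [TopologicalSpace W] [TopologicalSpace X] [TopologicalSpace Z]
  [CompactSpace W] [T2Space X]

theorem Topology.IsOpenEmbedding.continuous_extend {θ : W → X} (hθ : IsOpenEmbedding θ)
    {g : W → Z} {e : X → Z} (hg : Continuous g) (he : Continuous e) :
    Continuous (Function.extend θ g e) := by
  rw [continuous_iff_continuousAt]
  intro x
  by_cases hx : x ∈ range θ
  · obtain ⟨w, rfl⟩ := hx
    rw [← hθ.continuousAt_iff, Function.extend_comp hθ.injective]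
    exact hg.continuousAt
  · have h1 : (range θ)ᶜ ∈ 𝓝 x :=
      (isCompact_range hθ.continuous).isClosed.isOpen_compl.mem_nhds hx
    refine he.continuousAt.congr ?_
    filter_upwards [h1] with y hy
    rw [Function.extend_apply' _ _ _ fun ⟨w, hw⟩ => hy ⟨w, hw⟩]

/-- The extension of homeomorphisms of a compact space `W` to a space containing `W` as an
open subspace, by the identity outside `W`. -/
def Topology.IsOpenEmbedding.extendHomeo {θ : W → X} (hθ : IsOpenEmbedding θ) :
    (W ≃ₜ W) →* (X ≃ₜ X) :=
  have key : ∀ (π π' : W ≃ₜ W) (x : X), Function.extend θ (θ ∘ π) id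
      (Function.extend θ (θ ∘ π') id x) = Function.extend θ (θ ∘ (π * π' : W ≃ₜ W)) id x := by
    intro π π' x
    by_cases hx : ∃ w, θ w = x
    · obtain ⟨w, rfl⟩ := hx
      simp only [hθ.injective.extend_apply, Function.comp_apply]
      rfl
    · simp only [Function.extend_apply' _ _ _ hx, id]
  have one : ∀ x : X, Function.extend θ (θ ∘ (1 : W ≃ₜ W)) id x = x := by
    intro x
    by_cases hx : ∃ w, θ w = x
    · obtain ⟨w, rfl⟩ := hx
      simp only [hθ.injective.extend_apply, Function.comp_apply]
      rfl
    · simp only [Function.extend_apply' _ _ _ hx, id]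
  { toFun π :=
      { toFun := Function.extend θ (θ ∘ π) id
        invFun := Function.extend θ (θ ∘ (π⁻¹ : W ≃ₜ W)) id
        left_inv x := by rw [key, inv_mul_cancel, one]
        right_inv x := by rw [key, mul_inv_cancel, one]
        continuous_toFun := hθ.continuous_extend (hθ.continuous.comp π.continuous) continuous_id
        continuous_invFun := hθ.continuous_extend
          (hθ.continuous.comp (π⁻¹ : W ≃ₜ W).continuous) continuous_id }
    map_one' := Homeomorph.ext one
    map_mul' π π' := Homeomorph.ext fun x => (key π π' x).symm }

theorem Topology.IsOpenEmbedding.extendHomeo_apply {θ : W → X} (hθ : IsOpenEmbedding θ)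
    (π : W ≃ₜ W) (w : W) : hθ.extendHomeo π (θ w) = θ (π w) :=
  hθ.injective.extend_apply _ _ _

theorem Topology.IsOpenEmbedding.extendHomeo_apply_of_notMem {θ : W → X} (hθ : IsOpenEmbedding θ)
    (π : W ≃ₜ W) {x : X} (hx : x ∉ range θ) : hθ.extendHomeo π x = x :=
  Function.extend_apply' _ _ _ hx

end Extend

namespace EtaleGroupoid

/-! ### The topological full group and the index map -/

section FullGroup

variable {G X : Type*} [TopologicalSpace G] [TopologicalSpace X] {𝒢 : EtaleGroupoid G X}

theorem implements_range [CompactSpace X] {γ : X ≃ₜ X} {u : X → G} (hu : Continuous u)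
    (hs : ∀ x, 𝒢.s (u x) = x) (hr : ∀ x, 𝒢.r (u x) = γ x) : 𝒢.Implements (range u) γ where
  isCompact := isCompact_range hu
  isOpen := (isLocalHomeomorph_of_s hu isLocalHomeomorph_id hs).isOpenMap.isOpen_range
  injOn_s := by
    rintro _ ⟨x, rfl⟩ _ ⟨y, rfl⟩ h
    rw [hs, hs] at h
    rw [h]
  injOn_r := by
    rintro _ ⟨x, rfl⟩ _ ⟨y, rfl⟩ h
    rw [hr, hr] at h
    rw [γ.injective h]
  image_s := eq_univ_of_forall fun x => ⟨_, ⟨x, rfl⟩, hs x⟩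
  image_r := eq_univ_of_forall fun x =>
    ⟨_, ⟨γ.symm x, rfl⟩, (hr _).trans (γ.apply_symm_apply x)⟩
  apply_s := by
    rintro _ ⟨x, rfl⟩
    rw [hs, hr]

/-- A bisection implementing a homeomorphism is the image of a continuous section of the source
map. -/
theorem Implements.exists_section [T2Space X] {U : Set G} {γ : X ≃ₜ X} (h : 𝒢.Implements U γ) :
    ∃ u : X → G, Continuous u ∧ (∀ x, 𝒢.s (u x) = x) ∧ ∀ x, 𝒢.r (u x) = γ x := by
  have : CompactSpace U := isCompact_iff_compactSpace.1 h.isCompact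
  have hbij : Function.Bijective fun g : U => 𝒢.s g := by
    refine ⟨fun a b hab => Subtype.ext (h.injOn_s a.2 b.2 hab), fun x => ?_⟩
    obtain ⟨g, hg, rfl⟩ : x ∈ 𝒢.s '' U := h.image_s ▸ mem_univ x
    exact ⟨⟨g, hg⟩, rfl⟩
  let φ : U ≃ₜ X := Continuous.homeoOfEquivCompactToT2 (f := Equiv.ofBijective _ hbij)
    (𝒢.isLocalHomeomorph_s.continuous.comp continuous_subtype_val)
  have hφ : ∀ x, 𝒢.s (φ.symm x : G) = x := φ.apply_symm_apply
  refine ⟨fun x => φ.symm x, continuous_subtype_val.comp φ.symm.continuous, hφ, fun x => ?_⟩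
  rw [← h.apply_s _ (φ.symm x).2, hφ]

variable [T2Space X] [CompactSpace X]

theorem isOfFinOrder_coe_topFullGroup_iff {γ : 𝒢.topFullGroup} :
    IsOfFinOrder (γ : X ≃ₜ X) ↔ IsOfFinOrder γ :=
  Function.Injective.isOfFinOrder_iff (f := 𝒢.topFullGroup.subtype) Subtype.val_injective

/-- The bisection implementing an element of the full group, as a section of the source map. -/
def arrow (γ : 𝒢.topFullGroup) : X → G := γ.2.choose_spec.exists_section.choose

theorem continuous_arrow (γ : 𝒢.topFullGroup) : Continuous (arrow γ) :=
  γ.2.choose_spec.exists_section.choose_spec.1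

theorem s_arrow (γ : 𝒢.topFullGroup) (x : X) : 𝒢.s (arrow γ x) = x :=
  γ.2.choose_spec.exists_section.choose_spec.2.1 x

theorem r_arrow (γ : 𝒢.topFullGroup) (x : X) : 𝒢.r (arrow γ x) = (γ : X ≃ₜ X) x :=
  γ.2.choose_spec.exists_section.choose_spec.2.2 x

theorem isLocalHomeomorph_arrow (γ : 𝒢.topFullGroup) : IsLocalHomeomorph (arrow γ) :=
  isLocalHomeomorph_of_s (continuous_arrow γ) isLocalHomeomorph_id (s_arrow γ)

theorem implements_range_arrow (γ : 𝒢.topFullGroup) : 𝒢.Implements (range (arrow γ)) γ :=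
  implements_range (continuous_arrow γ) (s_arrow γ) (r_arrow γ)

/-- In a principal groupoid, elements of finite order in the full group are elementary: the set
of fixed points of a power is the preimage of the clopen set of units. -/
theorem IsPrincipal.isElementaryHomeo_iff [T2Space G] (h : 𝒢.IsPrincipal)
    (γ : 𝒢.topFullGroup) : IsElementaryHomeo (γ : X ≃ₜ X) ↔ IsOfFinOrder γ := by
  refine ⟨fun hγ => isOfFinOrder_coe_topFullGroup_iff.1 hγ.1,
    fun hγ => ⟨isOfFinOrder_coe_topFullGroup_iff.2 hγ, fun k => ?_⟩⟩
  have h1 : {x | ((γ : X ≃ₜ X) ^ k) x = x} = arrow (γ ^ k) ⁻¹' range 𝒢.unit := by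
    ext x
    rw [mem_preimage, h.mem_range_unit_iff, s_arrow, r_arrow]
    exact eq_comm
  rw [h1]
  exact IsClopen.preimage ⟨(isCompact_range 𝒢.continuous_unit).isClosed, 𝒢.isOpen_range_unit⟩
    (continuous_arrow _)

variable [T2Space G]

/-- The cycle `1_U` of an element of the full group. -/
def cycle (γ : 𝒢.topFullGroup) : C_c(G, ℤ) := pushforward (isLocalHomeomorph_arrow γ) (oneCc X)

theorem cycle_eq_indicatorCc (γ : 𝒢.topFullGroup) :
    cycle γ = indicatorCc (range (arrow γ)) (implements_range_arrow γ).isOpen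
      (implements_range_arrow γ).isCompact := by
  have hinj : Function.Injective (arrow γ) := fun x y hxy => by
    rw [← s_arrow γ x, hxy, s_arrow]
  rw [cycle, oneCc, pushforward_indicatorCc _ _ _ hinj.injOn]
  congr 1
  exact image_univ

theorem cycle_mem_ker (γ : 𝒢.topFullGroup) : cycle γ ∈ 𝒢.δ₁.ker := by
  rw [cycle_eq_indicatorCc]
  exact (implements_range_arrow γ).indicator_mem_ker

theorem cycle_nonneg (γ : 𝒢.topFullGroup) : 0 ≤ cycle γ :=
  pushforward_nonneg _ fun x => by simp [oneCc_apply]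

theorem cycle_apply_ne_zero {γ : 𝒢.topFullGroup} {g : G} (hg : cycle γ g ≠ 0) :
    g ∈ range (arrow γ) := by
  by_contra hne
  rw [cycle_eq_indicatorCc] at hg
  exact hg (indicator_of_notMem hne fun _ => (1 : ℤ))

theorem indexMap_eq_iff (h : 𝒢.IsEssentiallyPrincipal) (γ : 𝒢.topFullGroup) (f : 𝒢.δ₁.ker) :
    𝒢.indexMap h γ = Multiplicative.ofAdd (QuotientAddGroup.mk f) ↔
      (f : C_c(G, ℤ)) - cycle γ ∈ 𝒢.δ₂.range := by
  rw [𝒢.indexMap_apply h γ (implements_range_arrow γ), Implements.homologyClass,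
    Multiplicative.ofAdd.apply_eq_iff_eq, QuotientAddGroup.eq, AddSubgroup.mem_addSubgroupOf,
    cycle_eq_indicatorCc, sub_eq_neg_add]
  rfl

theorem indexMap_eq_one_iff (h : 𝒢.IsEssentiallyPrincipal) (γ : 𝒢.topFullGroup) :
    𝒢.indexMap h γ = 1 ↔ cycle γ ∈ 𝒢.δ₂.range := by
  have h1 := indexMap_eq_iff h γ 0
  rw [AddSubgroup.coe_zero, zero_sub, neg_mem_iff] at h1
  exact h1

/-- The index of an element of finite order vanishes: its powers form an elementary
subgroupoid, so its cycle has no crossing part for the corresponding orbit section. -/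
theorem IsPrincipal.indexMap_eq_one_of_isOfFinOrder [TotallyDisconnectedSpace X]
    (h : 𝒢.IsPrincipal) {γ : 𝒢.topFullGroup} (hγ : IsOfFinOrder γ) :
    𝒢.indexMap h.isEssentiallyPrincipal γ = 1 := by
  obtain ⟨n, hn, hγn⟩ := isOfFinOrder_iff_pow_eq_one.1 hγ
  let K : Set G := {g | ∃ i : ℕ, ((γ : X ≃ₜ X) ^ i) (𝒢.s g) = 𝒢.r g}
  have hpow : ∀ i, ((γ : X ≃ₜ X) ^ i) = (γ : X ≃ₜ X) ^ (i % n) := fun i => by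
    have h1 : (γ : X ≃ₜ X) ^ n = 1 := congrArg Subtype.val hγn
    exact pow_eq_pow_mod i h1
  have hKeq : K = ⋃ i ∈ Iio n, range (arrow (γ ^ i)) := by
    ext g
    simp only [K, mem_ofPred_eq, mem_iUnion, mem_range, mem_Iio, exists_prop]
    constructor
    · rintro ⟨i, hi⟩
      refine ⟨i % n, Nat.mod_lt _ hn, 𝒢.s g, h.ext (s_arrow _ _) ?_⟩
      rw [r_arrow, ← hi, hpow i]
      rfl
    · rintro ⟨i, -, x, rfl⟩
      exact ⟨i, by rw [s_arrow, r_arrow]; rfl⟩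
  have hK : 𝒢.IsElementarySubgroupoid K :=
    { isCompact := by
        rw [hKeq]
        exact (finite_Iio n).isCompact_biUnion fun i _ => isCompact_range (continuous_arrow _)
      isOpen := by
        rw [hKeq]
        exact isOpen_biUnion fun i _ => (implements_range_arrow _).isOpen
      unit_mem := fun x => ⟨0, by rw [𝒢.s_unit, 𝒢.r_unit]; rfl⟩
      inv_mem := by
        rintro g ⟨i, hi⟩
        refine ⟨i * (n - 1), ?_⟩
        rw [𝒢.s_inv, 𝒢.r_inv, ← hi, ← Homeomorph.mul_apply, ← pow_add]
        have h1 : i * (n - 1) + i = n * i := by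
          obtain ⟨m, rfl⟩ := Nat.exists_eq_succ_of_ne_zero hn.ne'
          simp only [Nat.succ_eq_add_one, Nat.add_sub_cancel]
          ring
        rw [h1, hpow, Nat.mul_mod_right]
        rfl
      mul_mem := by
        rintro g ⟨i, hi⟩ g' ⟨j, hj⟩ e
        refine ⟨i + j, ?_⟩
        rw [𝒢.s_mul, 𝒢.r_mul, ← hi, e, ← hj, pow_add]
        rfl
      principal := fun g _ hg => h.mem_range_unit_iff.2 hg.symm }
  obtain ⟨c, -, hc⟩ := hK.exists_orbitSection h
  rw [indexMap_eq_one_iff]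
  refine c.mem_range_δ₂ h (cycle_mem_ker γ) ?_
  rw [c.reduce_apply, c.cut_eq_zero h, map_zero]
  intro g hg
  obtain ⟨x, rfl⟩ := cycle_apply_ne_zero hg
  refine hc _ ⟨1, ?_⟩
  rw [s_arrow, r_arrow, pow_one]

end FullGroup

end EtaleGroupoid

theorem Function.exists_iterate_eq_self_of_ncard_le {α : Type*} (κ : α → α) (x : α)
    {F : Set α} (hF : F.Finite)
    {n : ℕ} (hn : F.ncard ≤ n) (hκ : ∀ i, κ^[i] x ∈ F) (hinj : Function.Injective κ) :
    ∃ i, 0 < i ∧ i ≤ n ∧ κ^[i] x = x := by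
  classical
  have h1 : hF.toFinset.card < (Finset.range (n + 1)).card := by
    rw [Finset.card_range, ← ncard_eq_toFinset_card _ hF]
    omega
  obtain ⟨i, hi, j, hj, hij, he⟩ := Finset.exists_ne_map_eq_of_card_lt_of_maps_to h1
    (f := fun i => κ^[i] x) fun i _ => by simpa using hκ i
  rw [Finset.mem_range] at hi hj
  wlog hlt : i < j generalizing i j
  · exact this j hj i hi hij.symm he.symm (by omega)
  refine ⟨j - i, by omega, by omega, ?_⟩
  have h2 : κ^[j] x = κ^[i] (κ^[j - i] x) := by
    rw [← Function.iterate_add_apply]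
    congr 1
    omega
  exact (hinj.iterate i (he.trans h2)).symm

namespace EtaleGroupoid

namespace OrbitSection

/-! ### The full group relative to an orbit section -/

variable {G X : Type*} [TopologicalSpace G] [TopologicalSpace X] {𝒢 : EtaleGroupoid G X}
  [T2Space X] (c : 𝒢.OrbitSection)

/-- A homeomorphism preserving the classes lies in the full group and, the classes being
of bounded size, has finite order. -/
theorem exists_of_proj_comp_eq [CompactSpace X] {κ : X ≃ₜ X} (hκ : ∀ x, c.proj (κ x) = c.proj x) :
    ∃ h : κ ∈ 𝒢.topFullGroup, IsOfFinOrder (⟨κ, h⟩ : 𝒢.topFullGroup) := by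
  have hmem : κ ∈ 𝒢.topFullGroup := by
    have e : ∀ x, 𝒢.s (c (κ x)) = 𝒢.r (𝒢.inv (c x)) := fun x => by
      rw [𝒢.r_inv, s_apply, s_apply, hκ]
    refine ⟨_, implements_range (u := fun x => 𝒢.mul (c (κ x)) (𝒢.inv (c x)) (e x))
      (continuous_mul_of (c.continuous_toFun.comp κ.continuous)
        (𝒢.continuous_inv.comp c.continuous_toFun) e) (fun x => ?_) fun x => ?_⟩
    · rw [𝒢.s_mul, 𝒢.s_inv, c.r_apply]
    · rw [𝒢.r_mul, c.r_apply]
  refine ⟨hmem, isOfFinOrder_coe_topFullGroup_iff.1 ?_⟩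
  have hp := c.isLocalHomeomorph_proj
  obtain ⟨n, hn⟩ : ∃ n : ℕ, ∀ y, (c.proj ⁻¹' {y}).ncard ≤ n := by
    obtain ⟨M, hM⟩ := (isCompact_range (pushforward hp (oneCc X)).continuous).bddAbove
    refine ⟨M.toNat, fun y => ?_⟩
    have h1 : pushforward hp (oneCc X) y ≤ M := hM (mem_range_self y)
    rw [pushforward_oneCc_apply] at h1
    omega
  refine isOfFinOrder_iff_pow_eq_one.2 ⟨n.factorial, n.factorial_pos, Homeomorph.ext fun x => ?_⟩
  have hiter : ∀ i : ℕ, ∀ x, (κ ^ i) x = κ^[i] x := fun i => by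
    induction i with
    | zero => exact fun _ => rfl
    | succ i ih =>
      intro x
      rw [pow_succ, Function.iterate_succ_apply, ← ih]
      rfl
  have hproj : ∀ i, κ^[i] x ∈ c.proj ⁻¹' {c.proj x} := fun i => by
    induction i with
    | zero => rfl
    | succ i ih =>
      rw [Function.iterate_succ_apply', mem_preimage, hκ]
      exact ih
  obtain ⟨i, hi, hin, hix⟩ := Function.exists_iterate_eq_self_of_ncard_le κ x (hp.finite_fiber (c.proj x))
    (hn _) hproj κ.injective
  obtain ⟨m, hm⟩ := Nat.dvd_factorial hi hin
  rw [hiter, hm, Function.iterate_mul]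
  exact Function.iterate_fixed hix m

section Extend

variable {W : Type*} [TopologicalSpace W] [CompactSpace W]

/-- Conjugating by the section turns arrows `φ w`, which move `w` to `π w` up to the classes, into
arrows that move `θ w` to `θ (π w)`. -/
theorem exists_section_extendHomeo {θ : W → X} (hθ : IsOpenEmbedding θ)
    (π : W ≃ₜ W) {φ : W → G} (hφ : Continuous φ)
    (hs : ∀ w, c.proj (θ w) = c.proj (𝒢.s (φ w)))
    (hr : ∀ w, c.proj (θ (π w)) = c.proj (𝒢.r (φ w))) :
    ∃ u : X → G, Continuous u ∧ (∀ x, 𝒢.s (u x) = x) ∧ (∀ x, 𝒢.r (u x) = hθ.extendHomeo π x) := by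
  have e₁ : ∀ w, 𝒢.s (c.retract (φ w)) = 𝒢.r (𝒢.inv (c (θ w))) := fun w => by
    rw [s_retract, 𝒢.r_inv, s_apply, hs]
  have e₂ : ∀ w, 𝒢.s (c (θ (π w))) = 𝒢.r (𝒢.mul _ _ (e₁ w)) := fun w => by
    rw [𝒢.r_mul, r_retract, s_apply, hr]
  let Φ : W → G := fun w => 𝒢.mul _ _ (e₂ w)
  have hΦ : Continuous Φ :=
    continuous_mul_of (c.continuous_toFun.comp (hθ.continuous.comp π.continuous))
      (continuous_mul_of (c.continuous_retract.comp hφ)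
        (𝒢.continuous_inv.comp (c.continuous_toFun.comp hθ.continuous)) e₁) e₂
  refine ⟨Function.extend θ Φ 𝒢.unit, hθ.continuous_extend hΦ 𝒢.continuous_unit,
    fun x => ?_, fun x => ?_⟩ <;> by_cases hx : x ∈ range θ
  · obtain ⟨w, rfl⟩ := hx
    rw [hθ.injective.extend_apply]
    simp only [Φ, 𝒢.s_mul, 𝒢.s_inv, c.r_apply]
  · rw [Function.extend_apply' _ _ _ hx, 𝒢.s_unit]
  · obtain ⟨w, rfl⟩ := hx
    rw [hθ.injective.extend_apply, hθ.extendHomeo_apply]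
    simp only [Φ, 𝒢.r_mul, c.r_apply]
  · rw [Function.extend_apply' _ _ _ hx, 𝒢.r_unit, hθ.extendHomeo_apply_of_notMem _ hx]

theorem extendHomeo_mem [CompactSpace X] {θ : W → X} (hθ : IsOpenEmbedding θ)
    (π : W ≃ₜ W) {φ : W → G} (hφ : Continuous φ)
    (hs : ∀ w, c.proj (θ w) = c.proj (𝒢.s (φ w)))
    (hr : ∀ w, c.proj (θ (π w)) = c.proj (𝒢.r (φ w))) :
    hθ.extendHomeo π ∈ 𝒢.topFullGroup := by
  obtain ⟨u, hu, hus, hur⟩ := c.exists_section_extendHomeo hθ π hφ hs hr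
  exact ⟨_, implements_range hu hus hur⟩

/-- The extension of a homeomorphism `π` moving `w` along the arrow `φ w` up to the classes has
the same crossing data as `φ`. -/
theorem reduce_cycle_extendHomeo [CompactSpace X] [T2Space G] [T2Space W] (h : 𝒢.IsPrincipal) {θ : W → X}
    (hθ : IsOpenEmbedding θ) (π : W ≃ₜ W) {φ : W → G} (hφ : IsLocalHomeomorph φ)
    (hs : ∀ w, c.proj (θ w) = c.proj (𝒢.s (φ w)))
    (hr : ∀ w, c.proj (θ (π w)) = c.proj (𝒢.r (φ w))) {γ : 𝒢.topFullGroup}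
    (hγ : (γ : X ≃ₜ X) = hθ.extendHomeo π) :
    c.reduce h (cycle γ) = c.reduce h (pushforward hφ (oneCc W)) := by
  have hu : IsClopen (range 𝒢.unit)ᶜ :=
    IsClopen.compl ⟨(isCompact_range 𝒢.continuous_unit).isClosed, 𝒢.isOpen_range_unit⟩
  rw [c.reduce_eq_restrictCc h _ hu, c.reduce_eq_restrictCc h _ hu]
  ext z
  rw [restrictCc_apply, restrictCc_apply]
  by_cases hz : z ∈ (range 𝒢.unit)ᶜ
  · rw [indicator_of_mem hz, indicator_of_mem hz, cycle, pushforward_pushforward,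
      pushforward_pushforward, pushforward_oneCc_apply, pushforward_oneCc_apply,
      ← ncard_image_of_injective _ hθ.injective]
    congr 2
    have key : ∀ w, c.retract (arrow γ (θ w)) = c.retract (φ w) := fun w =>
      c.retract_eq_retract h (by rw [s_arrow, hs])
        (by rw [r_arrow, hγ, hθ.extendHomeo_apply, hr])
    ext x
    simp only [mem_preimage, mem_singleton_iff, mem_image, Function.comp_apply]
    constructor
    · intro hx
      have hxr : x ∈ range θ := by
        by_contra hxr
        refine hz (hx ▸ ?_)
        rw [h.mem_range_unit_iff, s_retract, r_retract, s_arrow, r_arrow, hγ,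
          hθ.extendHomeo_apply_of_notMem _ hxr]
      obtain ⟨w, rfl⟩ := hxr
      exact ⟨w, (key w).symm.trans hx, rfl⟩
    · rintro ⟨w, hw, rfl⟩
      exact (key w).trans hw
  · rw [indicator_of_notMem hz, indicator_of_notMem hz]

end Extend

/-- Two elements of the full group with the same crossing data agree up to multiplication, on
both sides, by elements of finite order: matching their bisections over the crossing data gives
homeomorphisms which preserve the classes. -/
theorem exists_double_coset [CompactSpace X] [T2Space G] [TotallyDisconnectedSpace X]
    (h : 𝒢.IsPrincipal)
    {γ β : 𝒢.topFullGroup} (hγβ : c.reduce h (cycle γ) = c.reduce h (cycle β)) :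
    ∃ κ κ' : 𝒢.topFullGroup, IsOfFinOrder κ ∧ IsOfFinOrder κ' ∧ γ = κ' * β * κ := by
  have hps := c.isLocalHomeomorph_proj.comp 𝒢.isLocalHomeomorph_s
  have hq := c.isLocalHomeomorph_retract
  obtain ⟨D, hD⟩ : ∃ D, D = cycle γ - cycle β := ⟨_, rfl⟩
  have hDs : pushforward 𝒢.isLocalHomeomorph_s D = 0 := by
    rw [hD, map_sub, cycle, cycle,
      pushforward_pushforward_eq _ _ isLocalHomeomorph_id fun x _ => s_arrow γ x,
      pushforward_pushforward_eq _ _ isLocalHomeomorph_id fun x _ => s_arrow β x, sub_self]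
  have hqD : pushforward hq D = 0 := by
    have h1 : pushforward hq D = pushforward hq (D - c.cut h D) := by
      have h0 : c.reduce h D = 0 := by rw [hD, map_sub, hγβ, sub_self]
      rw [map_sub, ← reduce_apply, h0, sub_zero]
    have h2 : pushforward hq (D - c.cut h D) =
        pushforward 𝒢.isLocalHomeomorph_unit (pushforward hps (D - c.cut h D)) := by
      rw [pushforward_pushforward]
      refine pushforward_congr _ _ fun g hg => h.ext ?_ ?_
      · rw [s_retract, Function.comp_apply, 𝒢.s_unit]
        rfl
      · rw [r_retract, Function.comp_apply, 𝒢.r_unit, ← c.sub_cut_apply_ne_zero h hg]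
        rfl
    -- the total mass over each representative is zero, and units are determined by their source
    have h3 : pushforward hps (D - c.cut h D) = 0 := by
      have h4 : pushforward 𝒢.isLocalHomeomorph_s (pushforward hq D) = 0 := by
        rw [pushforward_pushforward_eq hq _ hps fun g _ => c.s_retract g,
          ← pushforward_pushforward 𝒢.isLocalHomeomorph_s c.isLocalHomeomorph_proj, hDs, map_zero]
      rw [h1, h2, pushforward_pushforward_eq _ _ isLocalHomeomorph_id fun x _ => 𝒢.s_unit x,
        pushforward_id] at h4
      exact h4
    rw [h1, h2, h3, map_zero]
  have hcard : ∀ z, ((c.retract ∘ arrow γ) ⁻¹' {z}).ncard = ((c.retract ∘ arrow β) ⁻¹' {z}).ncard := by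
    intro z
    rw [hD, map_sub, sub_eq_zero, cycle, cycle, pushforward_pushforward,
      pushforward_pushforward] at hqD
    have h1 := DFunLike.congr_fun hqD z
    rw [pushforward_oneCc_apply, pushforward_oneCc_apply] at h1
    exact_mod_cast h1
  have : TotallyDisconnectedSpace G := 𝒢.isLocalHomeomorph_s.totallyDisconnectedSpace
  obtain ⟨κ, hκ⟩ := exists_homeomorph_lift (hq.comp (isLocalHomeomorph_arrow γ))
    (hq.comp (isLocalHomeomorph_arrow β)) hcard
  have hκs : ∀ x, c.proj (κ x) = c.proj x := fun x => by
    have h1 := congrArg 𝒢.s (hκ x)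
    simpa only [Function.comp_apply, s_retract, s_arrow] using h1
  have hκr : ∀ x, c.proj ((β : X ≃ₜ X) (κ x)) = c.proj ((γ : X ≃ₜ X) x) := fun x => by
    have h1 := congrArg 𝒢.r (hκ x)
    simpa only [Function.comp_apply, r_retract, r_arrow] using h1
  obtain ⟨hκm, hκo⟩ := c.exists_of_proj_comp_eq hκs
  have hκ' : ∀ x, c.proj ((γ * κ⁻¹ * (β : X ≃ₜ X)⁻¹) x) = c.proj x := fun x => ?_
  · obtain ⟨hκm', hκo'⟩ := c.exists_of_proj_comp_eq hκ'
    refine ⟨⟨κ, hκm⟩, ⟨_, hκm'⟩, hκo, hκo', Subtype.ext ?_⟩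
    change (γ : X ≃ₜ X) = γ * κ⁻¹ * (β : X ≃ₜ X)⁻¹ * β * κ
    group
  obtain ⟨y, rfl⟩ := (β : X ≃ₜ X).surjective x
  obtain ⟨w, rfl⟩ := κ.surjective y
  change c.proj ((γ : X ≃ₜ X) (κ.symm ((β : X ≃ₜ X).symm ((β : X ≃ₜ X) (κ w))))) = _
  rw [Homeomorph.symm_apply_apply, Homeomorph.symm_apply_apply, hκr]

end OrbitSection

variable {G X : Type*} [TopologicalSpace G] [TopologicalSpace X] {𝒢 : EtaleGroupoid G X}

/-! ### Realizing cycles in the full group -/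

section Realization

variable [T2Space G] [T2Space X]
  (c : 𝒢.OrbitSection)

theorem pushforward_add_inv_mem_ker (f : C_c(G, ℤ)) :
    𝒢.δ₁ (f + pushforward 𝒢.isLocalHomeomorph_inv f) = 0 := by
  rw [δ₁, AddMonoidHom.sub_apply, map_add, map_add,
    pushforward_pushforward_eq _ _ 𝒢.isLocalHomeomorph_r fun g _ => 𝒢.s_inv g,
    pushforward_pushforward_eq _ _ 𝒢.isLocalHomeomorph_s fun g _ => 𝒢.r_inv g]
  abel

/-- The crossing arrows of a nonnegative cycle can be matched so that each of them ends in the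
class in which its successor starts. -/
theorem OrbitSection.exists_successor [TotallyDisconnectedSpace X] (h : 𝒢.IsPrincipal)
    {f : C_c(G, ℤ)} (hf : 0 ≤ f)
    (hδ : 𝒢.δ₁ f = 0) : ∃ π : Layers (c.cut h f) ≃ₜ Layers (c.cut h f),
      ∀ w, c.proj (𝒢.s (π w).1.1) = c.proj (𝒢.r w.1.1) := by
  have hpr := isLocalHomeomorph_layers (c.cut h f)
  refine exists_homeomorph_lift ((c.isLocalHomeomorph_proj.comp 𝒢.isLocalHomeomorph_r).comp hpr)
    ((c.isLocalHomeomorph_proj.comp 𝒢.isLocalHomeomorph_s).comp hpr) fun y => ?_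
  have h1 := DFunLike.congr_fun (c.pushforward_cut_of_mem_ker h hδ) y
  rw [← pushforward_layers (c.cut_nonneg h hf), pushforward_pushforward, pushforward_pushforward,
    pushforward_oneCc_apply, pushforward_oneCc_apply] at h1
  exact_mod_cast h1.symm

variable [CompactSpace X] [TotallyDisconnectedSpace X]

/-- A compact étale space over `G` whose total mass issuing from each class is at most the
size of the class embeds into the unit space, compatibly with the classes of the sources. -/
theorem OrbitSection.exists_placement {W : Type*} [TopologicalSpace W] [T2Space W] [CompactSpace W]
    {φ : W → G} (hφ : IsLocalHomeomorph φ)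
    (hle : pushforward (c.isLocalHomeomorph_proj.comp 𝒢.isLocalHomeomorph_s)
      (pushforward hφ (oneCc W)) ≤ pushforward c.isLocalHomeomorph_proj (oneCc X)) :
    ∃ θ : W → X, IsOpenEmbedding θ ∧ ∀ w, c.proj (θ w) = c.proj (𝒢.s (φ w)) := by
  refine exists_injective_lift ((c.isLocalHomeomorph_proj.comp 𝒢.isLocalHomeomorph_s).comp hφ)
    c.isLocalHomeomorph_proj fun y => ?_
  have h1 := hle y
  rw [pushforward_pushforward, pushforward_oneCc_apply, pushforward_oneCc_apply] at h1
  exact Nat.cast_le.1 h1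

/-- Every nonnegative cycle is homologous to the cycle of an element of the full group: place the
crossing arrows at distinct points of the classes in which they start, and move each of these
points to the place of the successor. -/
theorem IsAlmostFinite.exists_cycle_sub_mem_range (haf : 𝒢.IsAlmostFinite) (h : 𝒢.IsPrincipal)
    {f : C_c(G, ℤ)} (hf : 0 ≤ f) (hδ : 𝒢.δ₁ f = 0) :
    ∃ γ : 𝒢.topFullGroup, f - cycle γ ∈ 𝒢.δ₂.range := by
  obtain ⟨c, hc⟩ := haf.exists_orbitSection h hf
  have hpr := isLocalHomeomorph_layers (c.cut h f)
  have hpf := pushforward_layers (c.cut_nonneg h hf)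
  obtain ⟨π, hπ⟩ := c.exists_successor h hf hδ
  obtain ⟨θ, hθ, hθs⟩ := c.exists_placement hpr (by rwa [hpf])
  have hr : ∀ w, c.proj (θ (π w)) = c.proj (𝒢.r w.1.1) := fun w => by rw [hθs, hπ]
  refine ⟨⟨_, c.extendHomeo_mem hθ π hpr.continuous hθs hr⟩, c.mem_range_δ₂ h ?_ ?_⟩
  · rw [map_sub, hδ, cycle_mem_ker, sub_zero]
  · rw [map_sub, c.reduce_cycle_extendHomeo h hθ π hpr hθs hr rfl, hpf, c.reduce_cut, sub_self]

theorem IsAlmostFinite.indexMap_surjective (haf : 𝒢.IsAlmostFinite) (h : 𝒢.IsPrincipal) :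
    Function.Surjective (𝒢.indexMap h.isEssentiallyPrincipal) := by
  have key : ∀ f : 𝒢.δ₁.ker, 0 ≤ (f : C_c(G, ℤ)) →
      ∃ γ, 𝒢.indexMap h.isEssentiallyPrincipal γ = Multiplicative.ofAdd (QuotientAddGroup.mk f) := by
    intro f hf
    obtain ⟨γ, hγ⟩ := haf.exists_cycle_sub_mem_range h hf f.2
    exact ⟨γ, (indexMap_eq_iff _ γ f).2 hγ⟩
  intro a
  obtain ⟨f, hfa⟩ := QuotientAddGroup.mk_surjective (Multiplicative.toAdd a)
  -- every cycle is a difference of nonnegative cycles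
  set m : C_c(G, ℤ) := -(f : C_c(G, ℤ)) ⊔ 0 with hm
  have hm0 : 0 ≤ m := fun x => le_max_right _ _
  let f₂ : 𝒢.δ₁.ker := ⟨m + pushforward 𝒢.isLocalHomeomorph_inv m, pushforward_add_inv_mem_ker m⟩
  have hf₂ : 0 ≤ (f₂ : C_c(G, ℤ)) := fun x =>
    add_nonneg (hm0 x) (pushforward_nonneg 𝒢.isLocalHomeomorph_inv hm0 x)
  have hf₁ : 0 ≤ ((f + f₂ : 𝒢.δ₁.ker) : C_c(G, ℤ)) := fun x => by
    have h1 : -(f : C_c(G, ℤ)) x ≤ m x := le_max_left _ _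
    have h2 := pushforward_nonneg 𝒢.isLocalHomeomorph_inv hm0 x
    change 0 ≤ (f : C_c(G, ℤ)) x + (m x + pushforward 𝒢.isLocalHomeomorph_inv m x)
    have h3 : (0 : ℤ) ≤ pushforward 𝒢.isLocalHomeomorph_inv m x := h2
    linarith
  obtain ⟨γ₁, h₁⟩ := key _ hf₁
  obtain ⟨γ₂, h₂⟩ := key f₂ hf₂
  refine ⟨γ₁ * γ₂⁻¹, ?_⟩
  rw [map_mul, map_inv, h₁, h₂, ← ofAdd_neg, ← ofAdd_add, ← QuotientAddGroup.mk_neg,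
    ← QuotientAddGroup.mk_add, add_neg_cancel_right, hfa]
  rfl

end Realization

variable {G X : Type*} [TopologicalSpace G] [TopologicalSpace X] {𝒢 : EtaleGroupoid G X}

/-! ### Composable pairs as triangles -/

section Triangle

variable (𝒢) in
/-- The three arrows `b`, `a`, `(ab)⁻¹` of the triangle of a composable pair `(a, b)`, in cyclic
order: each starts where the previous one ends. -/
def side : Fin 3 → 𝒢.Pairs → G := ![𝒢.d₀, 𝒢.d₂, fun p => 𝒢.inv (𝒢.d₁ p)]

theorem isLocalHomeomorph_side (i : Fin 3) : IsLocalHomeomorph (𝒢.side i) := by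
  fin_cases i
  · exact 𝒢.isLocalHomeomorph_d₀
  · exact 𝒢.isLocalHomeomorph_d₂
  · exact 𝒢.isLocalHomeomorph_inv.comp 𝒢.isLocalHomeomorph_d₁

theorem s_side_add_one (i : Fin 3) (p : 𝒢.Pairs) : 𝒢.s (𝒢.side (i + 1) p) = 𝒢.r (𝒢.side i p) := by
  fin_cases i
  · exact p.2
  · exact (𝒢.s_inv _).trans (𝒢.r_mul _ _ _)
  · exact ((𝒢.r_inv _).trans (𝒢.s_mul _ _ _)).symm

/-- The degenerate triangle `(ab, s(b))` of a composable pair `(a, b)`; its sides are `ab`, its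
inverse and a unit. -/
def degenerate (p : 𝒢.Pairs) : 𝒢.Pairs :=
  ⟨(𝒢.d₁ p, 𝒢.unit (𝒢.s (𝒢.d₀ p))), (𝒢.s_mul _ _ _).trans (𝒢.r_unit _).symm⟩

theorem isLocalHomeomorph_degenerate : IsLocalHomeomorph (degenerate (𝒢 := 𝒢)) := by
  refine IsLocalHomeomorph.of_comp (g := 𝒢.d₂) 𝒢.isLocalHomeomorph_d₁ 𝒢.isLocalHomeomorph_d₂ ?_
  exact (𝒢.isLocalHomeomorph_d₁.continuous.prodMk (𝒢.continuous_unit.comp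
    (𝒢.isLocalHomeomorph_s.continuous.comp 𝒢.isLocalHomeomorph_d₀.continuous))).subtype_mk _

theorem d₁_degenerate (p : 𝒢.Pairs) : 𝒢.d₁ (degenerate p) = 𝒢.d₁ p :=
  mul_eq_left _ ⟨_, rfl⟩

/-- Rotation of the three sides of the triangles parametrized by `E`. -/
def rotation (E : Type*) [TopologicalSpace E] : E × Fin 3 ≃ₜ E × Fin 3 :=
  (Homeomorph.refl E).prodCongr (Equiv.toHomeomorphOfDiscrete (Equiv.addRight 1))

theorem rotation_pow_three (E : Type*) [TopologicalSpace E] : rotation E ^ 3 = 1 := by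
  refine Homeomorph.ext fun ⟨e, i⟩ => ?_
  change (e, i + 1 + 1 + 1) = (e, i)
  congr 1
  fin_cases i <;> rfl

theorem isLocalHomeomorph_side_layers (f : C_c(𝒢.Pairs, ℤ)) :
    IsLocalHomeomorph fun w : Layers f × Fin 3 => 𝒢.side w.2 w.1.1.1 :=
  .of_prod_discrete fun i => (isLocalHomeomorph_side i).comp (isLocalHomeomorph_layers f)

variable (𝒢) in
/-- Arrows starting where the sides of a triangle start, and which cross if `a` and `b` do. -/
def sideStart : Fin 3 → 𝒢.Pairs → G :=
  ![𝒢.d₀, fun p => 𝒢.inv (𝒢.d₀ p), fun p => 𝒢.inv (𝒢.d₂ p)]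

variable (𝒢) in
/-- Arrows starting where the sides of a degenerate triangle start, and which cross if `a` and `b`
do. -/
def degenerateStart : Fin 3 → 𝒢.Pairs → G :=
  ![𝒢.d₀, 𝒢.d₀, fun p => 𝒢.inv (𝒢.d₂ p)]

theorem isLocalHomeomorph_sideStart (i : Fin 3) : IsLocalHomeomorph (𝒢.sideStart i) := by
  fin_cases i
  · exact 𝒢.isLocalHomeomorph_d₀
  · exact 𝒢.isLocalHomeomorph_inv.comp 𝒢.isLocalHomeomorph_d₀
  · exact 𝒢.isLocalHomeomorph_inv.comp 𝒢.isLocalHomeomorph_d₂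

theorem isLocalHomeomorph_degenerateStart (i : Fin 3) :
    IsLocalHomeomorph (𝒢.degenerateStart i) := by
  fin_cases i
  · exact 𝒢.isLocalHomeomorph_d₀
  · exact 𝒢.isLocalHomeomorph_d₀
  · exact 𝒢.isLocalHomeomorph_inv.comp 𝒢.isLocalHomeomorph_d₂

theorem s_sideStart (i : Fin 3) (p : 𝒢.Pairs) : 𝒢.s (𝒢.side i p) = 𝒢.s (𝒢.sideStart i p) := by
  fin_cases i
  · rfl
  · exact p.2.trans (𝒢.s_inv _).symm
  · exact (𝒢.s_inv _).trans ((𝒢.r_mul _ _ _).trans (𝒢.s_inv _).symm)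

theorem s_degenerateStart (i : Fin 3) (p : 𝒢.Pairs) :
    𝒢.s (𝒢.side i (degenerate p)) = 𝒢.s (𝒢.degenerateStart i p) := by
  fin_cases i
  · exact 𝒢.s_unit _
  · exact 𝒢.s_mul _ _ _
  · refine (𝒢.s_inv _).trans ((congrArg 𝒢.r (d₁_degenerate p)).trans ?_)
    exact (𝒢.r_mul _ _ _).trans (𝒢.s_inv _).symm

namespace OrbitSection

variable (c : 𝒢.OrbitSection)

/-- The set of composable pairs both of whose arrows join different classes. -/
def crossingPairs : Set 𝒢.Pairs := 𝒢.d₂ ⁻¹' c.crossing ∩ 𝒢.d₀ ⁻¹' c.crossing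

theorem isClopen_crossingPairs [T2Space X] (h : 𝒢.IsPrincipal) : IsClopen c.crossingPairs :=
  ((c.isClopen_crossing h).preimage 𝒢.isLocalHomeomorph_d₂.continuous).inter
    ((c.isClopen_crossing h).preimage 𝒢.isLocalHomeomorph_d₀.continuous)

theorem inv_mem_crossing {g : G} (hg : g ∈ c.crossing) : 𝒢.inv g ∈ c.crossing := by
  change c.proj _ ≠ c.proj _
  rw [𝒢.s_inv, 𝒢.r_inv]
  exact hg.symm

theorem sideStart_mem_crossing (i : Fin 3) {p : 𝒢.Pairs} (hp : p ∈ c.crossingPairs) :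
    𝒢.sideStart i p ∈ c.crossing := by
  fin_cases i
  · exact hp.2
  · exact c.inv_mem_crossing hp.2
  · exact c.inv_mem_crossing hp.1

theorem degenerateStart_mem_crossing (i : Fin 3) {p : 𝒢.Pairs} (hp : p ∈ c.crossingPairs) :
    𝒢.degenerateStart i p ∈ c.crossing := by
  fin_cases i
  · exact hp.2
  · exact hp.2
  · exact c.inv_mem_crossing hp.1

end OrbitSection

variable [T2Space G]

variable (𝒢) in
/-- The sum of the sides of triangles, as a homomorphism on functions. -/
def perimeter : C_c(𝒢.Pairs, ℤ) →+ C_c(G, ℤ) :=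
  ∑ i, pushforward (isLocalHomeomorph_side i)

theorem perimeter_apply (f : C_c(𝒢.Pairs, ℤ)) :
    𝒢.perimeter f = ∑ i, pushforward (isLocalHomeomorph_side i) f :=
  AddMonoidHom.finsetSum_apply _ _ _

variable (𝒢) in
/-- A function on `G` which controls the number of crossings of triangles, and of the
corresponding degenerate triangles, independently of the orbit section. -/
def crossingBound : C_c(𝒢.Pairs, ℤ) →+ C_c(G, ℤ) :=
  ∑ i, (pushforward (isLocalHomeomorph_sideStart i) +
    pushforward (isLocalHomeomorph_degenerateStart i))

theorem crossingBound_nonneg {f : C_c(𝒢.Pairs, ℤ)} (hf : 0 ≤ f) : 0 ≤ 𝒢.crossingBound f := by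
  intro y
  simp only [crossingBound, AddMonoidHom.finsetSum_apply, AddMonoidHom.add_apply,
    CompactlySupportedContinuousMap.sum_apply, CompactlySupportedContinuousMap.add_apply]
  exact Finset.sum_nonneg fun i _ =>
    add_nonneg (pushforward_nonneg _ hf y) (pushforward_nonneg _ hf y)

theorem pushforward_side_layers {f : C_c(𝒢.Pairs, ℤ)} (hf : 0 ≤ f) :
    pushforward (isLocalHomeomorph_side_layers f) (oneCc (Layers f × Fin 3)) = 𝒢.perimeter f := by
  rw [perimeter_apply, pushforward_oneCc_prod
    fun i => (isLocalHomeomorph_side i).comp (isLocalHomeomorph_layers f)]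
  refine Finset.sum_congr rfl fun i _ => ?_
  conv_rhs => rw [← pushforward_layers hf, pushforward_pushforward]

variable [T2Space X]

namespace OrbitSection

variable (c : 𝒢.OrbitSection)

theorem reduce_pushforward_congr {Y : Type*} [TopologicalSpace Y] [T2Space Y] (h : 𝒢.IsPrincipal)
    {π π' : Y → G} (hπ : IsLocalHomeomorph π) (hπ' : IsLocalHomeomorph π') {f : C_c(Y, ℤ)}
    (hs : ∀ y, f y ≠ 0 → c.proj (𝒢.s (π y)) = c.proj (𝒢.s (π' y)))
    (hr : ∀ y, f y ≠ 0 → c.proj (𝒢.r (π y)) = c.proj (𝒢.r (π' y))) :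
    c.reduce h (pushforward hπ f) = c.reduce h (pushforward hπ' f) := by
  have h1 : restrictCc _ ((c.isClopen_crossing h).preimage hπ.continuous) f =
      restrictCc _ ((c.isClopen_crossing h).preimage hπ'.continuous) f := by
    ext y
    rw [restrictCc_apply, restrictCc_apply]
    by_cases hy : f y = 0
    · rw [indicator_apply_eq_zero.2 fun _ => hy, indicator_apply_eq_zero.2 fun _ => hy]
    · classical
      rw [indicator_apply, indicator_apply]
      refine if_congr ?_ rfl rfl
      change c.proj _ ≠ c.proj _ ↔ c.proj _ ≠ c.proj _
      rw [hs y hy, hr y hy]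
  rw [reduce_apply, reduce_apply, cut, restrictCc_pushforward, restrictCc_pushforward, h1,
    pushforward_pushforward, pushforward_pushforward]
  refine pushforward_congr _ _ fun y hy => ?_
  have hy' : f y ≠ 0 := (indicator_apply_ne_zero.1 hy).2
  exact c.retract_eq_retract h (hs y hy') (hr y hy')

theorem reduce_pushforward_eq_zero {Y : Type*} [TopologicalSpace Y] [T2Space Y]
    (h : 𝒢.IsPrincipal) {π : Y → G} (hπ : IsLocalHomeomorph π) {f : C_c(Y, ℤ)}
    (hf : ∀ y, f y ≠ 0 → c.proj (𝒢.s (π y)) = c.proj (𝒢.r (π y))) :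
    c.reduce h (pushforward hπ f) = 0 := by
  rw [reduce_apply, c.cut_eq_zero h, map_zero]
  intro g hg
  rw [pushforward_apply] at hg
  obtain ⟨y, rfl, hy⟩ := exists_ne_zero_of_finsum_mem_ne_zero hg
  exact hf y hy

/-- Up to classes, the boundary of a triangle is its perimeter minus the perimeter of the
corresponding degenerate triangle. -/
theorem reduce_perimeter_sub (h : 𝒢.IsPrincipal) (f : C_c(𝒢.Pairs, ℤ)) :
    c.reduce h (𝒢.perimeter f) =
      c.reduce h (𝒢.δ₂ f) +
        c.reduce h (𝒢.perimeter (pushforward isLocalHomeomorph_degenerate f)) := by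
  have hd := isLocalHomeomorph_degenerate (𝒢 := 𝒢)
  have h0 : c.reduce h (pushforward (isLocalHomeomorph_side 0) (pushforward hd f)) = 0 := by
    rw [pushforward_pushforward]
    refine c.reduce_pushforward_eq_zero h _ fun p _ => ?_
    change c.proj (𝒢.s (𝒢.unit _)) = c.proj (𝒢.r (𝒢.unit _))
    rw [𝒢.s_unit, 𝒢.r_unit]
  have h1 : pushforward (isLocalHomeomorph_side 1) (pushforward hd f) =
      pushforward 𝒢.isLocalHomeomorph_d₁ f :=
    pushforward_pushforward_eq _ _ _ fun _ _ => rfl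
  have h2 : pushforward (isLocalHomeomorph_side 2) (pushforward hd f) =
      pushforward (isLocalHomeomorph_side (𝒢 := 𝒢) 2) f :=
    pushforward_pushforward_eq _ _ _ fun p _ => congrArg 𝒢.inv (d₁_degenerate p)
  rw [perimeter_apply, perimeter_apply, Fin.sum_univ_three, Fin.sum_univ_three, h1, h2, δ₂]
  simp only [map_add, map_sub, AddMonoidHom.add_apply, AddMonoidHom.sub_apply, h0]
  rw [show pushforward (isLocalHomeomorph_side 0) f = pushforward 𝒢.isLocalHomeomorph_d₀ f from rfl,
    show pushforward (isLocalHomeomorph_side 1) f = pushforward 𝒢.isLocalHomeomorph_d₂ f from rfl]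
  abel

/-- Pairs `(a, b)` in which one arrow stays in its class do not contribute to the crossing data of
boundaries: the other arrow and `ab` have the same crossing data. -/
theorem reduce_δ₂_restrictCc (h : 𝒢.IsPrincipal) (f : C_c(𝒢.Pairs, ℤ)) :
    c.reduce h (𝒢.δ₂ (restrictCc _ (c.isClopen_crossingPairs h) f)) = c.reduce h (𝒢.δ₂ f) := by
  have hA := (c.isClopen_crossing h).preimage 𝒢.isLocalHomeomorph_d₂.continuous
  have hB := (c.isClopen_crossing h).preimage 𝒢.isLocalHomeomorph_d₀.continuous
  set A := 𝒢.d₂ ⁻¹' c.crossing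
  set B := 𝒢.d₀ ⁻¹' c.crossing
  have key₁ : c.reduce h (𝒢.δ₂ (restrictCc _ hA.compl f)) = 0 := by
    have hsup : ∀ p : 𝒢.Pairs, restrictCc _ hA.compl f p ≠ 0 →
        c.proj (𝒢.s (𝒢.d₂ p)) = c.proj (𝒢.r (𝒢.d₂ p)) := fun p hp =>
      not_not.1 (indicator_apply_ne_zero.1 hp).1
    rw [δ₂, AddMonoidHom.add_apply, AddMonoidHom.sub_apply, map_add, map_sub,
      c.reduce_pushforward_eq_zero h _ hsup,
      c.reduce_pushforward_congr h 𝒢.isLocalHomeomorph_d₀ 𝒢.isLocalHomeomorph_d₁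
        (fun p _ => congrArg c.proj (𝒢.s_mul _ _ _).symm) (fun p hp => ?_), sub_self, add_zero]
    rw [d₁, 𝒢.r_mul]
    exact (congrArg c.proj p.2).symm.trans (hsup p hp)
  have key₂ : c.reduce h (𝒢.δ₂ (restrictCc _ hB.compl (restrictCc _ hA f))) = 0 := by
    have hsup : ∀ p : 𝒢.Pairs, restrictCc _ hB.compl (restrictCc _ hA f) p ≠ 0 →
        c.proj (𝒢.s (𝒢.d₀ p)) = c.proj (𝒢.r (𝒢.d₀ p)) := fun p hp =>
      not_not.1 (indicator_apply_ne_zero.1 hp).1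
    rw [δ₂, AddMonoidHom.add_apply, AddMonoidHom.sub_apply, map_add, map_sub,
      c.reduce_pushforward_eq_zero h _ hsup,
      c.reduce_pushforward_congr h 𝒢.isLocalHomeomorph_d₂ 𝒢.isLocalHomeomorph_d₁
        (fun p hp => ?_) (fun p _ => congrArg c.proj (𝒢.r_mul _ _ _).symm), zero_sub,
      neg_add_cancel]
    rw [d₁, 𝒢.s_mul]
    exact (congrArg c.proj p.2).trans (hsup p hp).symm
  have hsplit : f = restrictCc _ hA.compl f + restrictCc _ hB.compl (restrictCc _ hA f) +
      restrictCc _ (c.isClopen_crossingPairs h) f := by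
    ext p
    simp only [CompactlySupportedContinuousMap.add_apply, restrictCc_apply]
    by_cases hpA : p ∈ A <;> by_cases hpB : p ∈ B <;>
      simp [hpA, hpB, crossingPairs, restrictCc_apply, A, B]
  conv_rhs => rw [hsplit, map_add, map_add, map_add, map_add, key₁, key₂, zero_add, zero_add]

/-- If `π` and `α` have the same sources and `α` maps `S` to crossing arrows, then the images
under `π` of the points of `S` issue from a class at most as often as the crossing images
under `α`. -/
theorem pushforward_restrictCc_le (h : 𝒢.IsPrincipal) {Y : Type*} [TopologicalSpace Y] [T2Space Y]
    {S : Set Y} (hS : IsClopen S) {π α : Y → G} (hπ : IsLocalHomeomorph π)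
    (hα : IsLocalHomeomorph α) (hαS : ∀ y ∈ S, α y ∈ c.crossing) (hs : ∀ y, 𝒢.s (π y) = 𝒢.s (α y))
    {f : C_c(Y, ℤ)} (hf : 0 ≤ f) :
    pushforward (c.isLocalHomeomorph_proj.comp 𝒢.isLocalHomeomorph_s)
        (pushforward hπ (restrictCc S hS f)) ≤
      pushforward (c.isLocalHomeomorph_proj.comp 𝒢.isLocalHomeomorph_s)
        (c.cut h (pushforward hα f)) := by
  have hps := c.isLocalHomeomorph_proj.comp 𝒢.isLocalHomeomorph_s
  have h1 : pushforward hps (pushforward hπ (restrictCc S hS f)) =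
      pushforward hps (pushforward hα (restrictCc S hS f)) := by
    rw [pushforward_pushforward hα]
    exact pushforward_pushforward_eq _ _ _ fun y _ => congrArg c.proj (hs y)
  rw [h1, cut, restrictCc_pushforward]
  exact pushforward_mono _ (pushforward_mono _ fun y =>
    indicator_le_indicator_of_subset hαS hf y)

end OrbitSection

/-- The sides of the triangles in `f`, and of the degenerate triangles in `f'`, restricted to
crossing pairs, issue from each class at most as often as the crossing arrows counted by
`crossingBound`. -/
theorem OrbitSection.pushforward_perimeter_le (c : 𝒢.OrbitSection) (h : 𝒢.IsPrincipal)
    {f f' : C_c(𝒢.Pairs, ℤ)} (hf : 0 ≤ f) (hf' : 0 ≤ f') :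
    pushforward (c.isLocalHomeomorph_proj.comp 𝒢.isLocalHomeomorph_s)
        (𝒢.perimeter (restrictCc _ (c.isClopen_crossingPairs h) f +
          pushforward isLocalHomeomorph_degenerate
            (restrictCc _ (c.isClopen_crossingPairs h) f'))) ≤
      pushforward (c.isLocalHomeomorph_proj.comp 𝒢.isLocalHomeomorph_s)
        (c.cut h (𝒢.crossingBound (f + f'))) := by
  intro y
  have hps := c.isLocalHomeomorph_proj.comp 𝒢.isLocalHomeomorph_s
  have h₁ : ∀ i, pushforward hps (pushforward (isLocalHomeomorph_side i)
      (restrictCc _ (c.isClopen_crossingPairs h) f)) y ≤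
      pushforward hps (c.cut h (pushforward (isLocalHomeomorph_sideStart i) f)) y := fun i =>
    c.pushforward_restrictCc_le h _ _ _ (fun _ hp => c.sideStart_mem_crossing i hp)
      (s_sideStart i) hf y
  have h₂ : ∀ i, pushforward hps (pushforward (isLocalHomeomorph_side i)
      (pushforward isLocalHomeomorph_degenerate
        (restrictCc _ (c.isClopen_crossingPairs h) f'))) y ≤
      pushforward hps (c.cut h (pushforward (isLocalHomeomorph_degenerateStart i) f')) y :=
    fun i => by
      rw [pushforward_pushforward isLocalHomeomorph_degenerate]
      exact c.pushforward_restrictCc_le h _ _ _ (fun _ hp => c.degenerateStart_mem_crossing i hp)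
        (s_degenerateStart i) hf' y
  have h₃ : ∀ i, 0 ≤
      pushforward hps (c.cut h (pushforward (isLocalHomeomorph_sideStart i) f')) y := fun i =>
    pushforward_nonneg _ (c.cut_nonneg h (pushforward_nonneg _ hf')) y
  have h₄ : ∀ i, 0 ≤
      pushforward hps (c.cut h (pushforward (isLocalHomeomorph_degenerateStart i) f)) y :=
    fun i => pushforward_nonneg _ (c.cut_nonneg h (pushforward_nonneg _ hf)) y
  simp only [perimeter_apply, crossingBound, AddMonoidHom.finsetSum_apply, AddMonoidHom.add_apply,
    map_sum, map_add, CompactlySupportedContinuousMap.sum_apply,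
    CompactlySupportedContinuousMap.add_apply]
  rw [← Finset.sum_add_distrib, ← Finset.sum_add_distrib]
  refine Finset.sum_le_sum (N := ℤ) fun i _ => ?_
  linarith [h₁ i, h₂ i, h₃ i, h₄ i]

end Triangle

variable {G X : Type*} [TopologicalSpace G] [TopologicalSpace X] {𝒢 : EtaleGroupoid G X}
  [T2Space G] [T2Space X]

/-! ### The kernel of the index map -/

/-- If `1_U = δ₂ (f₁ - f₂)`, then `U` together with the triangles of `f₂` and the degenerate
triangles of `f₁` has the same crossing data as the triangles of `f₁` with the degenerate triangles
of `f₂`. -/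
theorem OrbitSection.reduce_add_reduce_perimeter (c : 𝒢.OrbitSection) (h : 𝒢.IsPrincipal)
    (f₁ f₂ : C_c(𝒢.Pairs, ℤ)) :
    c.reduce h (𝒢.δ₂ (f₁ - f₂)) +
        c.reduce h (𝒢.perimeter (restrictCc _ (c.isClopen_crossingPairs h) f₂ +
          pushforward isLocalHomeomorph_degenerate
            (restrictCc _ (c.isClopen_crossingPairs h) f₁))) =
      c.reduce h (𝒢.perimeter (restrictCc _ (c.isClopen_crossingPairs h) f₁ +
          pushforward isLocalHomeomorph_degenerate
            (restrictCc _ (c.isClopen_crossingPairs h) f₂))) := by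
  rw [← c.reduce_δ₂_restrictCc h]
  simp only [map_add, map_sub, c.reduce_perimeter_sub h (restrictCc _ _ f₁),
    c.reduce_perimeter_sub h (restrictCc _ _ f₂)]
  abel

variable [CompactSpace X]

theorem IsPrincipal.mem_elementarySubgroup_of_isOfFinOrder (h : 𝒢.IsPrincipal)
    {γ : 𝒢.topFullGroup} (hγ : IsOfFinOrder γ) : γ ∈ 𝒢.elementarySubgroup :=
  Subgroup.subset_closure ((h.isElementaryHomeo_iff γ).2 hγ)

variable [TotallyDisconnectedSpace X]

theorem OrbitSection.mem_elementarySubgroup_of_reduce_eq (c : 𝒢.OrbitSection) (h : 𝒢.IsPrincipal)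
    {γ β : 𝒢.topFullGroup} (hγβ : c.reduce h (cycle γ) = c.reduce h (cycle β))
    (hβ : β ∈ 𝒢.elementarySubgroup) : γ ∈ 𝒢.elementarySubgroup := by
  obtain ⟨κ, κ', hκ, hκ', rfl⟩ := c.exists_double_coset h hγβ
  exact mul_mem (mul_mem (h.mem_elementarySubgroup_of_isOfFinOrder hκ') hβ)
    (h.mem_elementarySubgroup_of_isOfFinOrder hκ)

/-- An element of the full group whose cycle is a boundary is, up to multiplication by elements of
finite order, a product `α * δ⁻¹`. Here `α` permutes disjointly placed copies of the crossing
arrows of `γ` and of the triangles `t₁`, and `δ` permutes the copies of the triangles only; by the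
balance of crossing data, `α` is equivalent to a permutation `β` of other triangles. -/
theorem IsAlmostFinite.mem_elementarySubgroup (haf : 𝒢.IsAlmostFinite) (h : 𝒢.IsPrincipal)
    {γ : 𝒢.topFullGroup} (hγ : cycle γ ∈ 𝒢.δ₂.range) : γ ∈ 𝒢.elementarySubgroup := by
  obtain ⟨f, hf⟩ := hγ
  obtain ⟨f₁, f₂, hf₁, hf₂, rfl⟩ : ∃ f₁ f₂ : C_c(𝒢.Pairs, ℤ), 0 ≤ f₁ ∧ 0 ≤ f₂ ∧ f = f₁ - f₂ := by
    refine ⟨f ⊔ 0, f ⊔ 0 - f, fun x => le_max_right _ _, fun x => ?_, by abel⟩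
    exact sub_nonneg.2 (le_max_left (f x) 0)
  have hcross : ∀ {f f' : C_c(𝒢.Pairs, ℤ)}, 0 ≤ f → 0 ≤ f' → 0 ≤ f + f' :=
    fun hf hf' x => add_nonneg (hf x) (hf' x)
  obtain ⟨c, hc⟩ := haf.exists_orbitSection h (u := cycle γ + 𝒢.crossingBound (f₁ + f₂))
    fun x => add_nonneg (cycle_nonneg γ x) (crossingBound_nonneg (hcross hf₁ hf₂) x)
  have hps := c.isLocalHomeomorph_proj.comp 𝒢.isLocalHomeomorph_s
  have hbal := c.reduce_add_reduce_perimeter h f₁ f₂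
  have hle₁ := c.pushforward_perimeter_le h hf₂ hf₁
  have hle₂ := c.pushforward_perimeter_le h hf₁ hf₂
  have hpos : ∀ {f f' : C_c(𝒢.Pairs, ℤ)}, 0 ≤ f → 0 ≤ f' →
      0 ≤ restrictCc _ (c.isClopen_crossingPairs h) f + pushforward isLocalHomeomorph_degenerate
        (restrictCc _ (c.isClopen_crossingPairs h) f') := fun hf hf' =>
    hcross (restrictCc_nonneg _ _ hf) (pushforward_nonneg _ (restrictCc_nonneg _ _ hf'))
  have hn₁ := hpos hf₂ hf₁
  have hn₂ := hpos hf₁ hf₂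
  rw [add_comm f₂ f₁] at hle₁
  rw [hf] at hbal
  generalize restrictCc _ (c.isClopen_crossingPairs h) f₂ + pushforward isLocalHomeomorph_degenerate
    (restrictCc _ (c.isClopen_crossingPairs h) f₁) = t₁ at hbal hle₁ hn₁
  generalize restrictCc _ (c.isClopen_crossingPairs h) f₁ + pushforward isLocalHomeomorph_degenerate
    (restrictCc _ (c.isClopen_crossingPairs h) f₂) = t₂ at hbal hle₂ hn₂
  -- the parameter spaces: crossing arrows of `γ`, and sides of triangles
  have hφ := isLocalHomeomorph_layers (c.cut h (cycle γ))
  have hφ_one := pushforward_layers (c.cut_nonneg h (cycle_nonneg γ))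
  have hτ₁ := isLocalHomeomorph_side_layers t₁
  have hτ₂ := isLocalHomeomorph_side_layers t₂
  obtain ⟨π, hπ⟩ := c.exists_successor h (cycle_nonneg γ) (cycle_mem_ker γ)
  obtain ⟨θ₁, hθ₁, hs₁⟩ := c.exists_placement (hφ.sumElim hτ₁) (fun y => by
    rw [pushforward_oneCc_sumElim hφ hτ₁, hφ_one, pushforward_side_layers hn₁]
    refine le_trans ?_ (hc y)
    simp only [map_add, CompactlySupportedContinuousMap.add_apply]
    have := hle₁ y
    simp only [map_add] at this
    exact add_le_add_right this _)
  obtain ⟨θ₂, hθ₂, hs₂⟩ := c.exists_placement hτ₂ (fun y => by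
    rw [pushforward_side_layers hn₂]
    refine (hle₂ y).trans (le_trans ?_ (hc y))
    simp only [map_add, CompactlySupportedContinuousMap.add_apply]
    have := pushforward_nonneg hps (c.cut_nonneg h (cycle_nonneg γ)) y
    exact le_add_of_nonneg_left this)
  have hr₁ : ∀ w, c.proj (θ₁ (π.sumCongr (rotation _) w)) = c.proj (𝒢.r (Sum.elim
      (fun w : Layers (c.cut h (cycle γ)) => w.1.1)
      (fun w : Layers t₁ × Fin 3 => 𝒢.side w.2 w.1.1.1) w)) := by
    rintro (w | ⟨e, i⟩)
    · exact (hs₁ (.inl (π w))).trans (hπ w)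
    · exact (hs₁ (.inr (e, i + 1))).trans (congrArg c.proj (s_side_add_one i _))
  have hr₂ : ∀ w, c.proj (θ₂ (rotation _ w)) = c.proj (𝒢.r (𝒢.side w.2 w.1.1.1)) := by
    rintro ⟨e, i⟩
    exact (hs₂ (e, i + 1)).trans (congrArg c.proj (s_side_add_one i _))
  -- `α` moves both the crossing arrows of `γ` and the triangles of `t₁`, `β` the triangles of `t₂`
  let α : 𝒢.topFullGroup := ⟨hθ₁.extendHomeo (π.sumCongr (rotation _)),
    c.extendHomeo_mem hθ₁ _ (hφ.sumElim hτ₁).continuous hs₁ hr₁⟩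
  let β : 𝒢.topFullGroup := ⟨hθ₂.extendHomeo (rotation _),
    c.extendHomeo_mem hθ₂ _ hτ₂.continuous hs₂ hr₂⟩
  have hα : c.reduce h (cycle α) = c.reduce h (cycle β) := by
    rw [c.reduce_cycle_extendHomeo h hθ₁ _ (hφ.sumElim hτ₁) hs₁ hr₁ (γ := α) rfl,
      c.reduce_cycle_extendHomeo h hθ₂ _ hτ₂ hs₂ hr₂ (γ := β) rfl,
      pushforward_oneCc_sumElim hφ hτ₁,
      hφ_one, pushforward_side_layers hn₁, pushforward_side_layers hn₂, map_add, c.reduce_cut, hbal]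
  -- `α` is the product of its two parts `γ₁` and `δ`
  have hus := 𝒢.isLocalHomeomorph_unit.comp 𝒢.isLocalHomeomorph_s
  have hs₃ : ∀ w, c.proj (θ₁ w) = c.proj (𝒢.s (Sum.elim
      (fun w : Layers (c.cut h (cycle γ)) => 𝒢.unit (𝒢.s w.1.1))
      (fun w : Layers t₁ × Fin 3 => 𝒢.side w.2 w.1.1.1) w)) := by
    rintro (w | w)
    · exact (hs₁ (.inl w)).trans (congrArg c.proj (𝒢.s_unit _).symm)
    · exact hs₁ (.inr w)
  have hr₃ : ∀ w, c.proj (θ₁ ((Homeomorph.refl _).sumCongr (rotation _) w)) = c.proj (𝒢.r (Sum.elim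
      (fun w : Layers (c.cut h (cycle γ)) => 𝒢.unit (𝒢.s w.1.1))
      (fun w : Layers t₁ × Fin 3 => 𝒢.side w.2 w.1.1.1) w)) := by
    rintro (w | w)
    · exact (hs₁ (.inl w)).trans (congrArg c.proj (𝒢.r_unit _).symm)
    · exact hr₁ (.inr w)
  have hs₄ : ∀ w, c.proj (θ₁ w) = c.proj (𝒢.s (Sum.elim
      (fun w : Layers (c.cut h (cycle γ)) => w.1.1)
      (fun w : Layers t₁ × Fin 3 => 𝒢.unit (𝒢.s (𝒢.side w.2 w.1.1.1))) w)) := by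
    rintro (w | w)
    · exact hs₁ (.inl w)
    · exact (hs₁ (.inr w)).trans (congrArg c.proj (𝒢.s_unit _).symm)
  have hr₄ : ∀ w, c.proj (θ₁ (π.sumCongr (Homeomorph.refl _) w)) = c.proj (𝒢.r (Sum.elim
      (fun w : Layers (c.cut h (cycle γ)) => w.1.1)
      (fun w : Layers t₁ × Fin 3 => 𝒢.unit (𝒢.s (𝒢.side w.2 w.1.1.1))) w)) := by
    rintro (w | w)
    · exact hr₁ (.inl w)
    · exact (hs₁ (.inr w)).trans (congrArg c.proj (𝒢.r_unit _).symm)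
  let δ : 𝒢.topFullGroup := ⟨hθ₁.extendHomeo ((Homeomorph.refl _).sumCongr (rotation _)),
    c.extendHomeo_mem hθ₁ _ ((hus.comp hφ).sumElim hτ₁).continuous hs₃ hr₃⟩
  let γ₁ : 𝒢.topFullGroup := ⟨hθ₁.extendHomeo (π.sumCongr (Homeomorph.refl _)),
    c.extendHomeo_mem hθ₁ _ (hφ.sumElim (hus.comp hτ₁)).continuous hs₄ hr₄⟩
  have hγ₁ : γ₁ = α * δ⁻¹ := by
    rw [eq_mul_inv_iff_mul_eq]
    refine Subtype.ext ((map_mul hθ₁.extendHomeo _ _).symm.trans (congrArg _ ?_))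
    refine Homeomorph.ext ?_
    rintro (w | w) <;> rfl
  have hδ : IsOfFinOrder δ := by
    refine isOfFinOrder_coe_topFullGroup_iff.1 ((MonoidHom.isOfFinOrder _ ?_))
    refine isOfFinOrder_iff_pow_eq_one.2 ⟨3, by norm_num, Homeomorph.ext ?_⟩
    rintro (w | w)
    · rfl
    · exact congrArg Sum.inr (DFunLike.congr_fun (rotation_pow_three _) w)
  have hβ : IsOfFinOrder β :=
    isOfFinOrder_coe_topFullGroup_iff.1 (MonoidHom.isOfFinOrder _
      (isOfFinOrder_iff_pow_eq_one.2 ⟨3, by norm_num, rotation_pow_three _⟩))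
  have hγγ₁ : c.reduce h (cycle γ) = c.reduce h (cycle γ₁) := by
    rw [c.reduce_cycle_extendHomeo h hθ₁ _ (hφ.sumElim (hus.comp hτ₁)) hs₄ hr₄ (γ := γ₁) rfl,
      pushforward_oneCc_sumElim hφ (hus.comp hτ₁), hφ_one, map_add, c.reduce_cut,
      c.reduce_pushforward_eq_zero h (hus.comp hτ₁), add_zero]
    intro w _
    rw [Function.comp_apply, Function.comp_apply, 𝒢.s_unit, 𝒢.r_unit]
  refine c.mem_elementarySubgroup_of_reduce_eq h hγγ₁ ?_
  rw [hγ₁]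
  exact mul_mem (c.mem_elementarySubgroup_of_reduce_eq h hα
    (h.mem_elementarySubgroup_of_isOfFinOrder hβ))
    (inv_mem (h.mem_elementarySubgroup_of_isOfFinOrder hδ))

end EtaleGroupoid

end

theorem corollary7p13 {G X : Type*} [TopologicalSpace G] [TopologicalSpace X]
    [T2Space G] [LocallyCompactSpace G] [SecondCountableTopology G]
    [T2Space X] [CompactSpace X] [TotallyDisconnectedSpace X]
    (𝒢 : EtaleGroupoid G X) (hprin : 𝒢.IsPrincipal) (haf : 𝒢.IsAlmostFinite) :
    (𝒢.indexMap hprin.isEssentiallyPrincipal).ker = 𝒢.elementarySubgroup ∧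
    𝒢.elementarySubgroup = Subgroup.closure {γ : 𝒢.topFullGroup | IsOfFinOrder γ} ∧
    ∃ Φ : 𝒢.topFullGroup ⧸ 𝒢.elementarySubgroup ≃* Multiplicative 𝒢.H₁,
      ∀ γ : 𝒢.topFullGroup,
        Φ (QuotientGroup.mk γ) = 𝒢.indexMap hprin.isEssentiallyPrincipal γ := by
  have h1 : {γ : 𝒢.topFullGroup | EtaleGroupoid.IsElementaryHomeo (γ : X ≃ₜ X)} =
      {γ | IsOfFinOrder γ} := Set.ext fun γ => hprin.isElementaryHomeo_iff γ
  have h2 : 𝒢.elementarySubgroup = Subgroup.closure {γ : 𝒢.topFullGroup | IsOfFinOrder γ} := by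
    rw [EtaleGroupoid.elementarySubgroup, h1]
  have h3 : (𝒢.indexMap hprin.isEssentiallyPrincipal).ker = 𝒢.elementarySubgroup := by
    refine le_antisymm (fun γ hγ => ?_) ?_
    · exact haf.mem_elementarySubgroup hprin
        ((EtaleGroupoid.indexMap_eq_one_iff hprin.isEssentiallyPrincipal γ).1 hγ)
    · rw [h2, Subgroup.closure_le]
      exact fun γ hγ => hprin.indexMap_eq_one_of_isOfFinOrder hγ
  refine ⟨h3, h2, (QuotientGroup.quotientMulEquivOfEq h3.symm).trans
    (QuotientGroup.quotientKerEquivOfSurjective _ (haf.indexMap_surjective hprin)), fun γ => rfl⟩
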